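/- A pushdown energy game of dimension $n$ is $G=(Q_0,Q_1,\Gamma,\delta,n)$ with disjoint finite sets $Q_0,Q_1$ of control-states of Players $0$ and $1$, a finite stack alphabet $\Gamma$ and a finite set $\delta\subseteq (Q_0\cup Q_1)\times\Gamma\times(Q_0\cup Q_1)\times\Gamma^*\times\{-1,0,1\}^n$. Its game graph has the configurations $(Q_0\cup Q_1)\times\Gamma^+\times\mathbb{Z}^n$ and the edges $(q,X\alpha,E)\to(q',\beta\alpha,E+C)$ between configurations, for $(q,X,q',\beta,C)\in\delta$ and $\alpha\in\Gamma^*$; only games in which every configuration has an outgoing edge are considered. The owner of the control-state chooses the next edge; Player $0$ wins as soon as some component of the energy is negative, and Player $1$ wins every play in which this never happens. The fixed initial credit problem asks, given $G$, a control-state $q$, a stack content $w\in\Gamma^+$ and an energy $E\in\mathbb{N}^n$, whether Player $1$ has a winning strategy from $(q,w,E)$. The unknown initial credit problem asks, given $G$, $q$ and $w$, whether there exists $E\in\mathbb{N}^n$ such that Player $1$ has a winning strategy from $(q,w,E)$. A pushdown automaton (PDA) has finite sets $Q$, $\Gamma$ and $\mathit{Act}$ and a finite set of transitions $(q,X,a,q',\beta)\in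 Q\times\Gamma\times\mathit{Act}\times Q\times\Gamma^*$, inducing steps $(q,X\alpha)\xrightarrow{a}(q',\beta\alpha)$ on $Q\times\Gamma^+$. A one-counter net (a $1$-dimensional vector addition system with states) has a finite set of control-states $P$, a finite set $\mathit{Act}$ and a finite set of transitions $(p,a,p',d)\in P\times\mathit{Act}\times P\times\{-1,0,1\}$, inducing steps $(p,m)\xrightarrow{a}(p',m+d)$ on $P\times\mathbb{N}$ whenever $m+d\ge 0$. A configuration $s$ of a PDA is simulated by a configuration $t$ of a one-counter net over the same actions if some relation $R$ contains $(s,t)$ and satisfies: whenever $(u,v)\in R$ and $u\xrightarrow{a}u'$, there is $v\xrightarrow{a}v'$ with $(u',v')\in R$. **Theorem.** For every $n\ge 1$, in particular for $n=1$, the fixed initial credit problem and the unknown initial credit problem for $n$-dimensional pushdown energy games are both undecidable. Moreover, it is undecidable whether a given configuration of a given PDA is simulated by a given configuration of a given one-counter net. -/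

import Mathlib

/-! ### Algorithmic decidability -/

/-- The decision problem with instances `x : I`, presented to the algorithm as `code x`, and question
`P x` is decidable: some total computable function answers correctly on the code of every
instance.  (Nothing is required on inputs that are not the code of an instance.) -/
def DecidableProblem {I α : Type} [Primcodable α] (code : I → α) (P : I → Prop) : Prop :=
  ∃ f : α → Bool, Computable f ∧ ∀ x : I, f (code x) = true ↔ P x

/-! ### Pushdown energy games -/

/-- A pushdown energy game `(Q₀, Q₁, Γ, δ, n)` of dimension `n`, with
`Q₀ = Fin numStates₀`, `Q₁ = Fin numStates₁` (made disjoint by `⊕`) and `Γ = Fin numSymbols`.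
The finite transition relation is given by a list of its elements `(q, X, q', β, C)`;
`SignType` is the three-element set `{-1, 0, 1}`. -/
structure PushdownEnergyGame (n : ℕ) where
  numStates₀ : ℕ
  numStates₁ : ℕ
  numSymbols : ℕ
  transitions : List ((Fin numStates₀ ⊕ Fin numStates₁) × Fin numSymbols ×
    (Fin numStates₀ ⊕ Fin numStates₁) × List (Fin numSymbols) × (Fin n → SignType))

namespace PushdownEnergyGame

variable {n : ℕ}

/-- Control-states. -/
abbrev State (G : PushdownEnergyGame n) : Type := Fin G.numStates₀ ⊕ Fin G.numStates₁

/-- Configurations: elements of `(Q₀ ∪ Q₁) × Γ⁺ × ℤⁿ`; the head of `stack` is its top. -/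
structure Config (G : PushdownEnergyGame n) where
  state : G.State
  stack : List (Fin G.numSymbols)
  stack_ne : stack ≠ []
  energy : Fin n → ℤ

/-- The edges of the induced game graph. -/
def Step (G : PushdownEnergyGame n) (c c' : G.Config) : Prop :=
  ∃ X α β C, (c.state, X, c'.state, β, C) ∈ G.transitions ∧
    c.stack = X :: α ∧ c'.stack = β ++ α ∧ ∀ i, c'.energy i = c.energy i + (C i : ℤ)

/-- Every configuration has at least one outgoing transition. -/
def Total (G : PushdownEnergyGame n) : Prop := ∀ c : G.Config, ∃ c', G.Step c c'

/-- The configuration `c` belongs to Player 1. -/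
def OwnedByPlayer1 (G : PushdownEnergyGame n) (c : G.Config) : Prop := c.state.isRight = true

/-- A (history-dependent) strategy of Player 1: from the list of the previously visited
configurations and the current configuration of Player 1 it selects an outgoing transition. -/
structure Strategy1 (G : PushdownEnergyGame n) where
  move : List G.Config → G.Config → G.Config
  legal : ∀ h c, G.OwnedByPlayer1 c → G.Step c (move h c)

/-- An infinite path of the game graph. -/
def IsPlay (G : PushdownEnergyGame n) (ρ : ℕ → G.Config) : Prop :=
  ∀ k, G.Step (ρ k) (ρ (k + 1))

/-- Player 1 follows the strategy `σ` in the play `ρ`. -/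
def Strategy1.Follows {G : PushdownEnergyGame n} (σ : G.Strategy1) (ρ : ℕ → G.Config) : Prop :=
  ∀ k, G.OwnedByPlayer1 (ρ k) → ρ (k + 1) = σ.move ((List.range k).map ρ) (ρ k)

/-- Player 1 has a winning strategy from `c` (in a game where every configuration has an outgoing
transition): whatever Player 0 does, no component of the energy ever becomes negative. -/
def Player1Wins (G : PushdownEnergyGame n) (c : G.Config) : Prop :=
  ∃ σ : G.Strategy1, ∀ ρ : ℕ → G.Config, ρ 0 = c → G.IsPlay ρ → σ.Follows ρ →
    ∀ k i, 0 ≤ (ρ k).energy i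

/-- The finite description of a game that is given to an algorithm. -/
def code (G : PushdownEnergyGame n) :
    ℕ × ℕ × ℕ × List ((ℕ ⊕ ℕ) × ℕ × (ℕ ⊕ ℕ) × List ℕ × List ℤ) :=
  (G.numStates₀, G.numStates₁, G.numSymbols, G.transitions.map fun t =>
    (Sum.map Fin.val Fin.val t.1, t.2.1.val, Sum.map Fin.val Fin.val t.2.2.1,
      t.2.2.2.1.map Fin.val, List.ofFn fun i => (t.2.2.2.2 i : ℤ)))

end PushdownEnergyGame

/-- An instance of the unknown initial credit problem: a game in which every configuration
has an outgoing transition, an initial control-state and an initial stack content. -/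
structure UnknownCreditInstance (n : ℕ) where
  game : PushdownEnergyGame n
  total : game.Total
  state : game.State
  stack : List (Fin game.numSymbols)
  stack_ne : stack ≠ []

namespace UnknownCreditInstance

variable {n : ℕ}

/-- The initial configuration with a given initial energy. -/
def start (x : UnknownCreditInstance n) (E : Fin n → ℕ) : x.game.Config where
  state := x.state
  stack := x.stack
  stack_ne := x.stack_ne
  energy := fun i => (E i : ℤ)

/-- The question: is there an initial energy with which Player 1 can win? -/
def Holds (x : UnknownCreditInstance n) : Prop :=
  ∃ E : Fin n → ℕ, x.game.Player1Wins (x.start E)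

/-- The input given to an algorithm. -/
def code (x : UnknownCreditInstance n) :
    (ℕ × ℕ × ℕ × List ((ℕ ⊕ ℕ) × ℕ × (ℕ ⊕ ℕ) × List ℕ × List ℤ)) × (ℕ ⊕ ℕ) × List ℕ :=
  (x.game.code, Sum.map Fin.val Fin.val x.state, x.stack.map Fin.val)

end UnknownCreditInstance

/-- An instance of the fixed initial credit problem: as above, together with the initial energy. -/
structure FixedCreditInstance (n : ℕ) extends UnknownCreditInstance n where
  credit : Fin n → ℕ

namespace FixedCreditInstance

variable {n : ℕ}

/-- The question: can Player 1 win with the given initial energy? -/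
def Holds (x : FixedCreditInstance n) : Prop := x.game.Player1Wins (x.start x.credit)

/-- The input given to an algorithm. -/
def code (x : FixedCreditInstance n) :
    ((ℕ × ℕ × ℕ × List ((ℕ ⊕ ℕ) × ℕ × (ℕ ⊕ ℕ) × List ℕ × List ℤ)) × (ℕ ⊕ ℕ) × List ℕ) ×
      List ℕ :=
  (x.toUnknownCreditInstance.code, List.ofFn x.credit)

end FixedCreditInstance

/-! ### Simulation between pushdown automata and vector addition systems with states -/

/-- A pushdown automaton over the actions `Fin m`, with its finite set of transitions
`(q, X, a, q', β)` given by a list. -/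
structure PushdownAutomaton (m : ℕ) where
  numStates : ℕ
  numSymbols : ℕ
  transitions : List (Fin numStates × Fin numSymbols × Fin m × Fin numStates ×
    List (Fin numSymbols))

namespace PushdownAutomaton

variable {m : ℕ}

/-- Configurations: elements of `Q × Γ⁺`; the head of `stack` is its top. -/
structure Config (A : PushdownAutomaton m) where
  state : Fin A.numStates
  stack : List (Fin A.numSymbols)
  stack_ne : stack ≠ []

/-- The induced labeled transition relation. -/
def Step (A : PushdownAutomaton m) (c : A.Config) (a : Fin m) (c' : A.Config) : Prop :=
  ∃ X α β, (c.state, X, a, c'.state, β) ∈ A.transitions ∧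
    c.stack = X :: α ∧ c'.stack = β ++ α

/-- The finite description given to an algorithm. -/
def code (A : PushdownAutomaton m) : ℕ × ℕ × List (ℕ × ℕ × ℕ × ℕ × List ℕ) :=
  (A.numStates, A.numSymbols, A.transitions.map fun t =>
    (t.1.val, t.2.1.val, t.2.2.1.val, t.2.2.2.1.val, t.2.2.2.2.map Fin.val))

end PushdownAutomaton

/-- An `n`-dimensional vector addition system with states over the actions `Fin m`, with its
finite set of transitions `(q, a, q', D)` given by a list. For `n = 1` this is a one-counter
net. -/
structure VASS (m n : ℕ) where
  numStates : ℕ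
  transitions : List (Fin numStates × Fin m × Fin numStates × (Fin n → SignType))

namespace VASS

variable {m n : ℕ}

/-- Configurations: elements of `Q × ℕⁿ`. -/
structure Config (B : VASS m n) where
  state : Fin B.numStates
  counters : Fin n → ℕ

/-- The induced labeled transition relation; a transition that would make a counter negative is
disabled. -/
def Step (B : VASS m n) (c : B.Config) (a : Fin m) (c' : B.Config) : Prop :=
  ∃ D, (c.state, a, c'.state, D) ∈ B.transitions ∧
    ∀ i, (c'.counters i : ℤ) = (c.counters i : ℤ) + (D i : ℤ)

/-- The finite description given to an algorithm. -/
def code (B : VASS m n) : ℕ × List (ℕ × ℕ × ℕ × List ℤ) :=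
  (B.numStates, B.transitions.map fun t =>
    (t.1.val, t.2.1.val, t.2.2.1.val, List.ofFn fun i => (t.2.2.2 i : ℤ)))

end VASS

/-- `R` is a simulation between two labeled transition systems. -/
def IsSimulation {S T L : Type} (stepS : S → L → S → Prop) (stepT : T → L → T → Prop)
    (R : S → T → Prop) : Prop :=
  ∀ s t, R s t → ∀ a s', stepS s a s' → ∃ t', stepT t a t' ∧ R s' t'

/-- Simulation preorder: `t` simulates `s`, i.e. some simulation contains `(s, t)`. -/
def SimulatedBy {S T L : Type} (stepS : S → L → S → Prop) (stepT : T → L → T → Prop)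
    (s : S) (t : T) : Prop :=
  ∃ R : S → T → Prop, IsSimulation stepS stepT R ∧ R s t

/-- An instance of the simulation problem: a pushdown automaton and a one-counter net over the same
finite set of actions, each with an initial configuration. -/
structure SimulationInstance where
  numActions : ℕ
  pda : PushdownAutomaton numActions
  net : VASS numActions 1
  pdaStart : pda.Config
  netStart : net.Config

namespace SimulationInstance

/-- The question: is the pushdown configuration simulated by the configuration of the net? -/
def Holds (x : SimulationInstance) : Prop :=
  SimulatedBy x.pda.Step x.net.Step x.pdaStart x.netStart

/-- The input given to an algorithm. -/
def code (x : SimulationInstance) :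
    ℕ × ((ℕ × ℕ × List (ℕ × ℕ × ℕ × ℕ × List ℕ)) × ℕ × List ℕ) ×
      ((ℕ × List (ℕ × ℕ × ℕ × List ℤ)) × ℕ × ℕ) :=
  (x.numActions,
    (x.pda.code, x.pdaStart.state.val, x.pdaStart.stack.map Fin.val),
    (x.net.code, x.netStart.state.val, x.netStart.counters 0))

end SimulationInstance

/-!
# Undecidability of pushdown energy games and of simulation between pushdown automata and nets

All three problems are reduced from the halting problem of one fixed finite counter machine `M`
whose set of halting inputs is not computable (`exists_undecidable_machine`). The machine comes
from compiling the primitive recursive function "`k` steps suffice to evaluate the `n`-th partial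
recursive function at `0`" into a counter program (`ProgComputes.of_primrec'`), and searching
for `k`.

In the game, Player 0 runs `M`. The stack records the history of all increments and decrements, and
the energy is (at least) the length of this history. At each test of a register Player 0 claims
that the register is positive, or that it is not, and Player 1 accepts or challenges the claim.
After a challenge the history is popped and each operation costs `0`, `1` or `2` units of energy, in
such a way that the energy left at the end is a linear function of the contents of the tested register
(`histCost_eq`): it is nonnegative if the claim was false, and it is smaller than the energy before
the input was loaded if the claim was true. Costs are never negative, so the energy cannot become
negative on the way to a nonnegative final value; this is what the credit of `1` per operation is
for. After the test the game starts afresh with the energy that is left. If `M` halts, Player 0 has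
the energy drained.

If `M` does not halt, Player 1 wins with initial energy `0` by challenging exactly the false claims
(`player1Wins_of_not_halts`). If `M` halts, Player 0 makes only true claims; each challenge costs
Player 1 energy, so Player 0 wins whatever the initial energy is (`lost_restart`). Hence the same
game serves for the fixed and for the unknown initial credit problem. All components of the energy
change in the same way, so the dimension plays no role. The input occurs only in the words
pushed by two transitions, which makes the reduction computable (`primrec_code_machineArena`).

For the simulation problem the pushdown automaton runs `M` and the counter of the net plays the role
of the energy. The net challenges a claim by entering a control-state in which it can
perform everything for ever, except that the popping of an operation costs energy
(`simulatedBy_of_not_halts`, `unmatched_of_halts`). When `M` halts, the automaton performs an action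
that is impossible for a net that has accepted all claims.
-/

/-! ### Counter machines -/

/-- An instruction of a counter machine with control-states `Q` and integer registers `R`:
increment (`true`) or decrement (`false`) a register, branch on whether a register is positive
(first successor) or not (second successor), or halt. -/
inductive Instr (Q R : Type) : Type
  | op (r : R) (b : Bool) (q : Q)
  | test (r : R) (q₁ q₀ : Q)
  | halt

/-- Rename control-states and registers. -/
def Instr.map {Q R Q' R' : Type} (f : Q → Q') (g : R → R') : Instr Q R → Instr Q' R'
  | .op r b q => .op (g r) b (f q)
  | .test r q₁ q₀ => .test (g r) (f q₁) (f q₀)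
  | .halt => .halt

section Machine

variable {Q R : Type} [DecidableEq R]

/-- Add `1` (`true`) or `-1` (`false`) to the register `r`. -/
def bump (s : R → ℤ) (r : R) (b : Bool) : R → ℤ :=
  Function.update s r (s r + if b then 1 else -1)

/-- One step of the counter machine whose instruction at `q` is `M q`. -/
def machineStep (M : Q → Instr Q R) (c : Q × (R → ℤ)) : Option (Q × (R → ℤ)) :=
  match M c.1 with
  | .op r b q => some (q, bump c.2 r b)
  | .test r q₁ q₀ => some (if 1 ≤ c.2 r then q₁ else q₀, c.2)
  | .halt => none

/-- The run from control-state `q` with register contents `s` reaches a halting instruction. -/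
def Halts (M : Q → Instr Q R) (q : Q) (s : R → ℤ) : Prop :=
  (StateTransition.eval (machineStep M) (q, s)).Dom

theorem halts_of_reaches {M : Q → Instr Q R} {c c' : Q × (R → ℤ)}
    (h : StateTransition.Reaches (machineStep M) c c') :
    Halts M c.1 c.2 ↔ Halts M c'.1 c'.2 := by
  unfold Halts
  rw [StateTransition.reaches_eval h]

theorem halts_op {M : Q → Instr Q R} {q q' : Q} {r : R} {b : Bool} (h : M q = .op r b q')
    (s : R → ℤ) : Halts M q s ↔ Halts M q' (bump s r b) :=
  halts_of_reaches (c := (q, s)) (c' := (q', bump s r b))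
    (.single (by simp [machineStep, h]))

theorem halts_test {M : Q → Instr Q R} {q q₁ q₀ : Q} {r : R} (h : M q = .test r q₁ q₀)
    (s : R → ℤ) : Halts M q s ↔ Halts M (if 1 ≤ s r then q₁ else q₀) s :=
  halts_of_reaches (c := (q, s)) (c' := (if 1 ≤ s r then q₁ else q₀, s))
    (.single (by simp [machineStep, h]))

theorem halts_halt {M : Q → Instr Q R} {q : Q} (h : M q = .halt) (s : R → ℤ) : Halts M q s :=
  Part.dom_iff_mem.2 ⟨(q, s), StateTransition.mem_eval.2 ⟨.refl, by simp [machineStep, h]⟩⟩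

/-- Induction along a halting run. -/
theorem Halts.induction {M : Q → Instr Q R} {P : Q → (R → ℤ) → Prop}
    (halt : ∀ q s, M q = .halt → P q s)
    (op : ∀ q s r b q', M q = .op r b q' → P q' (bump s r b) → P q s)
    (test : ∀ q s r q₁ q₀, M q = .test r q₁ q₀ → P (if 1 ≤ s r then q₁ else q₀) s → P q s)
    {q : Q} {s : R → ℤ} (h : Halts M q s) : P q s := by
  obtain ⟨c, hc⟩ := Part.dom_iff_mem.1 h
  refine StateTransition.evalInduction (C := fun c => P c.1 c.2) hc fun c _ ih => ?_
  match hi : M c.1 with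
  | .op r b q' => exact op _ _ _ _ _ hi (ih (q', bump c.2 r b) (by simp [machineStep, hi]))
  | .test r q₁ q₀ =>
    exact test _ _ _ _ _ hi (ih (if 1 ≤ c.2 r then q₁ else q₀, c.2) (by simp [machineStep, hi]))
  | .halt => exact halt _ _ hi

/-- A machine cannot halt from a set of configurations each of which leads, in at least one step,
back into the set. -/
theorem not_halts_of_recurrent {M : Q → Instr Q R} (S : Set (Q × (R → ℤ)))
    (hS : ∀ c ∈ S, ∃ c' ∈ S, StateTransition.Reaches₁ (machineStep M) c c')
    {c : Q × (R → ℤ)} (hc : c ∈ S) : ¬ Halts M c.1 c.2 := by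
  intro h
  obtain ⟨e, he⟩ := Part.dom_iff_mem.1 h
  refine StateTransition.evalInduction
    (C := fun c => (∃ c' ∈ S, StateTransition.Reaches (machineStep M) c c') → False) he
    (fun a _ ih ⟨c', hc', hr⟩ => ?_) ⟨c, hc, .refl⟩
  have key : ∃ c' ∈ S, StateTransition.Reaches₁ (machineStep M) a c' := by
    obtain ⟨c'', h₁, h₂⟩ := hS c' hc'
    exact ⟨c'', h₁, h₂.trans_right hr⟩
  obtain ⟨c', hc', hr⟩ := key
  obtain ⟨b, hb, hr⟩ := Relation.TransGen.head'_iff.1 hr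
  exact ih b hb ⟨c', hc', hr⟩

/-- The machine `M'` simulates `M` on the control-states in `S`, whose instructions stay inside `S`
and mention only registers in `T`. -/
theorem halts_map_iff {Q' R' : Type} [DecidableEq R'] {M : Q → Instr Q R} {M' : Q' → Instr Q' R'}
    {f : Q → Q'} {g : R → R'} {S : Set Q} {T : Set R} (hg : Set.InjOn g T)
    (hM : ∀ q ∈ S, M' (f q) = (M q).map f g)
    (hop : ∀ q ∈ S, ∀ r b q', M q = .op r b q' → q' ∈ S ∧ r ∈ T)
    (htest : ∀ q ∈ S, ∀ r q₁ q₀, M q = .test r q₁ q₀ → q₁ ∈ S ∧ q₀ ∈ S ∧ r ∈ T)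
    {q : Q} (hq : q ∈ S) {s : R → ℤ} {s' : R' → ℤ} (hs : ∀ r ∈ T, s' (g r) = s r) :
    Halts M' (f q) s' ↔ Halts M q s := by
  refine StateTransition.tr_eval_dom (f₁ := machineStep M) (f₂ := machineStep M')
    (tr := fun c c' => c.1 ∈ S ∧ c'.1 = f c.1 ∧ ∀ r ∈ T, c'.2 (g r) = c.2 r) ?_ ⟨hq, rfl, hs⟩
  rintro ⟨q, s⟩ ⟨_, s'⟩ ⟨hq, rfl, hs⟩
  change q ∈ S at hq
  change ∀ r ∈ T, s' (g r) = s r at hs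
  match hi : M q with
  | .op r b q' =>
    obtain ⟨h₁, h₂⟩ := hop q hq r b q' hi
    simp only [machineStep, hi]
    refine ⟨(f q', bump s' (g r) b), ⟨h₁, rfl, fun t ht => ?_⟩,
      .single (by simp [machineStep, hM q hq, hi, Instr.map])⟩
    by_cases h : t = r
    · subst h; simp [bump, hs t ht]
    · have : g t ≠ g r := fun e => h (hg ht h₂ e)
      simp [bump, h, this, hs t ht]
  | .test r q₁ q₀ =>
    obtain ⟨h₁, h₀, h₂⟩ := htest q hq r q₁ q₀ hi
    simp only [machineStep, hi]
    refine ⟨(f (if 1 ≤ s r then q₁ else q₀), s'), ⟨?_, rfl, hs⟩,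
      .single (by simp [machineStep, hM q hq, hi, Instr.map, hs r h₂, apply_ite f])⟩
    change (if 1 ≤ s r then q₁ else q₀) ∈ S
    split_ifs <;> assumption
  | .halt => simp [machineStep, hi, hM q hq, Instr.map]

end Machine

/-! ### Structured counter programs -/

/-- Counter programs with while loops; registers are numbered by `ℕ`. -/
inductive Prog : Type
  | op (r : ℕ) (b : Bool)
  | seq (p₁ p₂ : Prog)
  | while (r : ℕ) (p : Prog)

/-- The counter machine that runs structured programs: its control-state is the list of programs
that remain to be executed. -/
def progMachine : List Prog → Instr (List Prog) ℕ
  | [] => .halt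
  | .op r b :: k => .op r b k
  | .seq p₁ p₂ :: k => .test 0 (p₁ :: p₂ :: k) (p₁ :: p₂ :: k)
  | .while r p :: k => .test r (p :: .while r p :: k) k

/-- Started with registers `s`, the program `p` terminates with registers `s'`. -/
def Exec (p : Prog) (s s' : ℕ → ℤ) : Prop :=
  ∀ k, StateTransition.Reaches₁ (machineStep progMachine) (p :: k, s) (k, s')

namespace Exec

theorem op (r : ℕ) (b : Bool) (s : ℕ → ℤ) : Exec (.op r b) s (bump s r b) :=
  fun k => .single (by simp [machineStep, progMachine])

theorem seq {p₁ p₂ : Prog} {s t u : ℕ → ℤ} (h₁ : Exec p₁ s t) (h₂ : Exec p₂ t u) :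
    Exec (.seq p₁ p₂) s u :=
  fun k => .head (b := (p₁ :: p₂ :: k, s)) (by simp [machineStep, progMachine])
    ((h₁ _).trans (h₂ _))

theorem while_done {r : ℕ} {p : Prog} {s : ℕ → ℤ} (h : s r ≤ 0) : Exec (.while r p) s s :=
  fun k => .single (by simp [machineStep, progMachine]; omega)

theorem while_step {r : ℕ} {p : Prog} {s t u : ℕ → ℤ} (h : 1 ≤ s r) (h₁ : Exec p s t)
    (h₂ : Exec (.while r p) t u) : Exec (.while r p) s u :=
  fun k => .head (b := (p :: .while r p :: k, s)) (by simp [machineStep, progMachine, h])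
    ((h₁ _).trans (h₂ _))

/-- A loop whose control register is decremented by each execution of the body; `I m` is the
invariant at the loop head when the control register contains `m`. -/
theorem while_count {r : ℕ} {p : Prog} {I : ℕ → (ℕ → ℤ) → Prop}
    (hr : ∀ m s, I m s → s r = m)
    (hp : ∀ m s, I (m + 1) s → ∃ t, Exec p s t ∧ I m t) :
    ∀ m s, I m s → ∃ t, Exec (.while r p) s t ∧ I 0 t
  | 0, s, hs => ⟨s, while_done (by simp [hr 0 s hs]), hs⟩
  | m + 1, s, hs => by
    obtain ⟨t, h₁, ht⟩ := hp m s hs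
    obtain ⟨u, h₂, hu⟩ := while_count hr hp m t ht
    exact ⟨u, while_step (by rw [hr _ s hs]; push_cast; omega) h₁ h₂, hu⟩

end Exec

namespace Prog

/-- A program without effect. -/
def skip : Prog := .seq (.op 0 true) (.op 0 false)

/-- Set the register `r` to zero. -/
def clear (r : ℕ) : Prog := .while r (.op r false)

/-- Add the contents of register `a` to register `b`, setting `a` to zero. -/
def move (a b : ℕ) : Prog := .while a (.seq (.op a false) (.op b true))

/-- Add the contents of register `a` to register `b`, with `t` as an auxiliary register. -/
def copy (a b t : ℕ) : Prog :=
  .seq (.while a (.seq (.op a false) (.seq (.op b true) (.op t true)))) (move t a)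

theorem exec_skip (s : ℕ → ℤ) : Exec skip s s := by
  have h := (Exec.op 0 true s).seq (Exec.op 0 false _)
  have e : bump (bump s 0 true) 0 false = s := by
    funext x
    by_cases hx : x = 0
    · subst hx; simp [bump]
    · simp [bump, hx]
  rwa [e] at h

theorem exec_clear (r : ℕ) (s : ℕ → ℤ) (h : 0 ≤ s r) :
    ∃ t, Exec (clear r) s t ∧ t r = 0 ∧ ∀ x ≠ r, t x = s x := by
  obtain ⟨m, hm⟩ := Int.eq_ofNat_of_zero_le h
  obtain ⟨t, h₁, h₂, h₃⟩ := Exec.while_count (r := r) (p := .op r false)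
    (I := fun m t => t r = m ∧ ∀ x ≠ r, t x = s x) (fun _ _ h => h.1)
    (fun m t ht => ⟨_, Exec.op r false t, by simp [bump, ht.1], fun x hx => by
      simp [bump, hx, ht.2 x hx]⟩) m s ⟨hm, fun _ _ => rfl⟩
  exact ⟨t, h₁, h₂, h₃⟩

theorem exec_move {a b : ℕ} (hab : a ≠ b) (s : ℕ → ℤ) (h : 0 ≤ s a) :
    ∃ t, Exec (move a b) s t ∧ t a = 0 ∧ t b = s b + s a ∧ ∀ x, x ≠ a → x ≠ b → t x = s x := by
  obtain ⟨m, hm⟩ := Int.eq_ofNat_of_zero_le h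
  obtain ⟨t, h₁, h₂, h₃, h₄⟩ := Exec.while_count (r := a) (p := .seq (.op a false) (.op b true))
    (I := fun m t => t a = m ∧ t b = s b + s a - m ∧ ∀ x, x ≠ a → x ≠ b → t x = s x)
    (fun _ _ h => h.1)
    (fun m t ht => ⟨_, (Exec.op a false t).seq (Exec.op b true _), by simp [bump, ht.1, hab],
      by simp [bump, ht.2.1, hab.symm]; ring, fun x hx hx' => by
      simp [bump, hx, hx', ht.2.2 x hx hx']⟩) m s ⟨hm, by simp [hm], fun _ _ _ => rfl⟩
  exact ⟨t, h₁, h₂, by simpa using h₃, h₄⟩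

theorem exec_copy {a b c : ℕ} (hab : a ≠ b) (hac : a ≠ c) (hbc : b ≠ c) (s : ℕ → ℤ)
    (h : 0 ≤ s a) (hc : s c = 0) :
    ∃ t, Exec (copy a b c) s t ∧ t b = s b + s a ∧ ∀ x, x ≠ b → t x = s x := by
  obtain ⟨m, hm⟩ := Int.eq_ofNat_of_zero_le h
  obtain ⟨t, h₁, h₂, h₃, h₄, h₅⟩ := Exec.while_count (r := a)
    (p := .seq (.op a false) (.seq (.op b true) (.op c true)))
    (I := fun m t => t a = m ∧ t b = s b + s a - m ∧ t c = s a - m ∧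
      ∀ x, x ≠ a → x ≠ b → x ≠ c → t x = s x)
    (fun _ _ h => h.1)
    (fun m t ht => ⟨_, (Exec.op a false t).seq ((Exec.op b true _).seq (Exec.op c true _)),
      by simp [bump, ht.1, hab, hac],
      by simp [bump, ht.2.1, hab.symm, hbc]; ring,
      by simp [bump, ht.2.2.1, hac.symm, hbc.symm]; ring, fun x hx hx' hx'' => by
      simp [bump, hx, hx', hx'', ht.2.2.2 x hx hx' hx'']⟩) m s
      ⟨hm, by simp [hm], by simp [hm, hc], fun _ _ _ _ => rfl⟩
  obtain ⟨u, g₁, g₂, g₃, g₄⟩ := exec_move hac.symm t (by rw [h₄]; simpa using h)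
  refine ⟨u, h₁.seq g₁, ?_, fun x hx => ?_⟩
  · rw [g₄ b hbc hab.symm, h₃]; simp
  · by_cases hxa : x = a
    · subst hxa; rw [g₃, h₂, h₄]; simp
    by_cases hxc : x = c
    · subst hxc; rw [g₂, hc]
    rw [g₄ x hxc hxa, h₅ x hxa hx hxc]

theorem exists_clear_block (N : ℕ) : ∀ j : ℕ, ∃ p, ∀ s : ℕ → ℤ, (∀ r, N ≤ r → 0 ≤ s r) →
    ∃ t, Exec p s t ∧ (∀ i < j, t (N + i) = 0) ∧ ∀ x, x < N ∨ N + j ≤ x → t x = s x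
  | 0 => ⟨skip, fun s _ => ⟨s, exec_skip s, by simp, fun _ _ => rfl⟩⟩
  | j + 1 => by
    obtain ⟨p, hp⟩ := exists_clear_block N j
    refine ⟨.seq p (clear (N + j)), fun s hs => ?_⟩
    obtain ⟨t, h₁, h₂, h₃⟩ := hp s hs
    obtain ⟨u, g₁, g₂, g₃⟩ := exec_clear (N + j) t
      (by rw [h₃ _ (Or.inr le_rfl)]; exact hs _ (by omega))
    refine ⟨u, h₁.seq g₁, fun i hi => ?_, fun x hx => ?_⟩
    · by_cases e : i = j
      · rw [e, g₂]
      · rw [g₃ _ (by omega), h₂ i (by omega)]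
    · rw [g₃ _ (by omega), h₃ x (by omega)]

end Prog

/-- The function `f` is computed by counter programs: whatever input registers `ins`, output
register `out` and bound `N` on them are prescribed, some program puts the value of `f` into `out`
and preserves all other registers, provided that `out` and all registers from `N` on are zero at
the start. -/
def ProgComputes {n : ℕ} (f : List.Vector ℕ n → ℕ) : Prop :=
  ∀ (ins : Fin n → ℕ) (out N : ℕ), (∀ i, ins i < N) → out < N → (∀ i, ins i ≠ out) →
    ∃ p, ∀ (s : ℕ → ℤ) (v : List.Vector ℕ n), (∀ i, s (ins i) = v.get i) → s out = 0 →
      (∀ r, N ≤ r → s r = 0) → ∃ t, Exec p s t ∧ t out = f v ∧ ∀ x ≠ out, t x = s x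

namespace ProgComputes

open Prog

theorem zero : ProgComputes (n := 0) fun _ => 0 :=
  fun _ _ _ _ _ _ => ⟨skip, fun s _ _ h₀ _ => ⟨s, exec_skip s, by simp [h₀], fun _ _ => rfl⟩⟩

theorem get {n : ℕ} (i : Fin n) : ProgComputes fun v => v.get i :=
  fun ins out N hi ho hio => ⟨copy (ins i) out N, fun s v hv h₀ hN => by
    have := hi i
    obtain ⟨t, h₁, h₂, h₃⟩ := exec_copy (c := N) (hio i) (by omega) (by omega) s
      (by rw [hv]; positivity) (hN N le_rfl)
    exact ⟨t, h₁, by rw [h₂, h₀, hv, zero_add], h₃⟩⟩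

theorem succ : ProgComputes (n := 1) fun v => Nat.succ v.head :=
  fun ins out N hi ho hio => by
    obtain ⟨p, hp⟩ := get (0 : Fin 1) ins out N hi ho hio
    refine ⟨.seq p (.op out true), fun s v hv h₀ hN => ?_⟩
    obtain ⟨t, h₁, h₂, h₃⟩ := hp s v hv h₀ hN
    exact ⟨_, h₁.seq (Exec.op out true t), by simp [bump, h₂], fun x hx => by
      simp [bump, hx, h₃ x hx]⟩

/-- Several functions of the same arguments can be computed into consecutive registers. -/
theorem exists_block {m n : ℕ} {g : Fin n → List.Vector ℕ m → ℕ} (hg : ∀ i, ProgComputes (g i))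
    (ins : Fin m → ℕ) (N : ℕ) (hi : ∀ i, ins i < N) : ∀ j ≤ n,
    ∃ p, ∀ (s : ℕ → ℤ) (v : List.Vector ℕ m), (∀ i, s (ins i) = v.get i) →
      (∀ r, N ≤ r → s r = 0) → ∃ t, Exec p s t ∧
        (∀ i : Fin n, i.1 < j → t (N + i) = g i v) ∧ ∀ x, x < N ∨ N + j ≤ x → t x = s x
  | 0, _ => ⟨skip, fun s _ _ _ => ⟨s, exec_skip s, by simp, fun _ _ => rfl⟩⟩
  | j + 1, hj => by
    obtain ⟨p, hp⟩ := exists_block hg ins N hi j (by omega)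
    obtain ⟨p', hp'⟩ := hg ⟨j, hj⟩ ins (N + j) (N + n)
      (fun i => by have := hi i; omega) (by omega) (fun i => by have := hi i; omega)
    refine ⟨.seq p p', fun s v hv hN => ?_⟩
    obtain ⟨t, h₁, h₂, h₃⟩ := hp s v hv hN
    obtain ⟨u, g₁, g₂, g₃⟩ := hp' t v (fun i => by rw [h₃ _ (Or.inl (hi i)), hv])
      (by rw [h₃ _ (by omega), hN _ (by omega)])
      (fun r hr => by rw [h₃ _ (by omega), hN _ (by omega)])
    refine ⟨u, h₁.seq g₁, fun i hij => ?_, fun x hx => ?_⟩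
    · by_cases e : i.1 = j
      · obtain ⟨i, hi⟩ := i
        subst e
        exact g₂
      · rw [g₃ _ (by omega), h₂ i (by omega)]
    · rw [g₃ _ (by omega), h₃ x (by omega)]

theorem comp {m n : ℕ} {f : List.Vector ℕ n → ℕ} {g : Fin n → List.Vector ℕ m → ℕ}
    (hf : ProgComputes f) (hg : ∀ i, ProgComputes (g i)) :
    ProgComputes fun a => f (List.Vector.ofFn fun i => g i a) := fun ins out N hi ho hio => by
  obtain ⟨p₁, hp₁⟩ := exists_block hg ins N hi n le_rfl
  obtain ⟨p₂, hp₂⟩ := hf (fun i => N + i) out (N + n) (fun i => by omega) (by omega)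
    (fun i => by omega)
  obtain ⟨p₃, hp₃⟩ := exists_clear_block N n
  refine ⟨.seq p₁ (.seq p₂ p₃), fun s v hv h₀ hN => ?_⟩
  obtain ⟨t, h₁, h₂, h₃⟩ := hp₁ s v hv hN
  obtain ⟨u, g₁, g₂, g₃⟩ := hp₂ t (List.Vector.ofFn fun i => g i v)
    (fun i => by simpa using h₂ i i.2) (by rw [h₃ _ (Or.inl ho), h₀])
    (fun r hr => by rw [h₃ _ (Or.inr hr), hN _ (by omega)])
  have hu : ∀ r, N ≤ r → 0 ≤ u r := fun r hr => by
    rw [g₃ _ (by omega)]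
    by_cases e : r < N + n
    · have := h₂ ⟨r - N, by omega⟩ (by simp; omega)
      simp only [Nat.add_sub_cancel' hr] at this
      rw [this]
      positivity
    · rw [h₃ _ (by omega), hN _ hr]
  obtain ⟨w, k₁, k₂, k₃⟩ := hp₃ u hu
  refine ⟨w, h₁.seq (g₁.seq k₁), by rw [k₃ _ (Or.inl ho), g₂], fun x hx => ?_⟩
  by_cases e : x < N ∨ N + n ≤ x
  · rw [k₃ _ e, g₃ _ hx, h₃ _ e]
  · have := k₂ (x - N) (by omega)
    rw [Nat.add_sub_cancel' (by omega)] at this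
    rw [this, hN _ (by omega)]

theorem prec {n : ℕ} {f : List.Vector ℕ n → ℕ} {g : List.Vector ℕ (n + 2) → ℕ}
    (hf : ProgComputes f) (hg : ProgComputes g) :
    ProgComputes fun v : List.Vector ℕ (n + 1) =>
      v.head.rec (f v.tail) fun y IH => g (y ::ᵥ IH ::ᵥ v.tail) := fun ins out N hi ho hio => by
  -- Register `N` counts down the remaining rounds, `N + 1` counts them up, and `N + 2` receives
  -- the next value before it is moved to `out`.
  obtain ⟨p₁, hp₁⟩ := get (0 : Fin (n + 1)) ins N (N + 3) (fun i => by have := hi i; omega)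
    (by omega) (fun i => by have := hi i; omega)
  obtain ⟨p₂, hp₂⟩ := hf (fun i => ins i.succ) out (N + 3) (fun i => by have := hi i.succ; omega)
    (by omega) (fun i => hio _)
  obtain ⟨p₃, hp₃⟩ := hg (Fin.cons (N + 1) (Fin.cons out fun i => ins i.succ)) (N + 2) (N + 3)
    (Fin.cases (by simp) (Fin.cases (by simp; omega) fun i => by
      have := hi i.succ; simp; omega)) (by omega)
    (Fin.cases (by simp) (Fin.cases (by simp; omega) fun i => by
      have := hi i.succ; simp; omega))
  let body : Prog := .seq (.op N false) (.seq p₃ (.seq (clear out) (.seq (move (N + 2) out)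
    (.op (N + 1) true))))
  refine ⟨.seq p₁ (.seq p₂ (.seq (.while N body) (clear (N + 1)))), fun s v hv h₀ hN => ?_⟩
  set F : ℕ → ℕ := fun m => Nat.rec (f v.tail) (fun y IH => g (y ::ᵥ IH ::ᵥ v.tail)) m with hF
  obtain ⟨t, h₁, h₂, h₃⟩ := hp₁ s v hv (hN _ le_rfl) (fun r hr => hN _ (by omega))
  obtain ⟨u, g₁, g₂, g₃⟩ := hp₂ t v.tail
    (fun i => by have := hi i.succ; rw [h₃ _ (by omega), hv]; simp)
    (by rw [h₃ _ (by omega), h₀]) (fun r hr => by rw [h₃ _ (by omega), hN _ (by omega)])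
  obtain ⟨w, k₁, k₂, -, k₃, k₄, k₅⟩ := Exec.while_count (r := N) (p := body)
    (I := fun m t => t N = m ∧ m ≤ v.head ∧ t out = F (v.head - m) ∧
      t (N + 1) = (v.head - m : ℕ) ∧ ∀ x, x ≠ N → x ≠ N + 1 → x ≠ out → t x = s x)
    (fun _ _ h => h.1)
    (fun m t ⟨a₁, a₂, a₃, a₄, a₅⟩ => by
      set y := v.head - (m + 1) with hy
      obtain ⟨t₂, b₁, b₂, b₃⟩ := hp₃ (bump t N false) (y ::ᵥ F y ::ᵥ v.tail)
        (Fin.cases (by simp [bump, a₄]) (Fin.cases (by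
            have : out ≠ N := by omega
            simp only [bump, Fin.cons_succ, Fin.cons_zero, ne_eq, this, not_false_eq_true,
              Function.update_of_ne, a₃]
            rfl) fun i => by
          have h₁ := hi i.succ
          have h₂ : ins i.succ ≠ N := by omega
          simp [bump, h₂, a₅ _ h₂ (by omega) (hio _), hv]))
        (by simp [bump, a₅ (N + 2) (by omega) (by omega) (by omega), hN])
        (fun r hr => by
          have h₂ : r ≠ N := by omega
          simp only [bump, ne_eq, h₂, not_false_eq_true, Function.update_of_ne]
          rw [a₅ r (by omega) (by omega) (by omega), hN _ (by omega)])
      obtain ⟨t₃, c₁, c₂, c₃⟩ := exec_clear out t₂ (by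
        have : out ≠ N := by omega
        rw [b₃ _ (by omega)]
        simp [bump, this, a₃])
      obtain ⟨t₄, d₁, d₂, d₃, d₄⟩ := exec_move (a := N + 2) (b := out) (by omega) t₃ (by
        rw [c₃ _ (by omega), b₂]; positivity)
      refine ⟨_, (Exec.op N false t).seq (b₁.seq (c₁.seq (d₁.seq (Exec.op (N + 1) true t₄)))),
        ?_, by omega, ?_, ?_, fun x hx hx' hx'' => ?_⟩
      · simp only [bump, ne_eq, Nat.left_eq_add, one_ne_zero, not_false_eq_true,
          Function.update_of_ne]
        rw [d₄ _ (by omega) (by omega), c₃ _ (by omega), b₃ _ (by omega)]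
        simp [bump, a₁]
      · have e : out ≠ N + 1 := by omega
        have e' : v.head - m = y + 1 := by omega
        rw [e']
        simp only [bump, ne_eq, e, not_false_eq_true, Function.update_of_ne]
        rw [d₃, c₂, c₃ _ (by omega), b₂, zero_add]
      · have e' : v.head - m = y + 1 := by omega
        rw [e']
        simp only [bump, Function.update_self]
        rw [d₄ _ (by omega) (by omega), c₃ _ (by omega), b₃ _ (by omega)]
        simp [bump, a₄]
      · simp only [bump, ne_eq, hx', not_false_eq_true, Function.update_of_ne]
        by_cases e : x = N + 2
        · rw [e, d₂, hN _ (by omega)]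
        · rw [d₄ _ e hx'', c₃ _ hx'', b₃ _ e]
          simp [bump, hx, a₅ x hx hx' hx''])
    v.head u ⟨by rw [g₃ _ (by omega), h₂]; simp, le_rfl, by simp [g₂, hF],
      by rw [g₃ _ (by omega), h₃ _ (by omega), hN _ (by omega)]; simp,
      fun x hx _ hx' => by rw [g₃ _ hx', h₃ _ hx]⟩
  obtain ⟨z, l₁, l₂, l₃⟩ := exec_clear (N + 1) w (by rw [k₄]; positivity)
  refine ⟨z, h₁.seq (g₁.seq (k₁.seq l₁)), by rw [l₃ _ (by omega), k₃]; simp [hF],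
    fun x hx => ?_⟩
  by_cases e₁ : x = N + 1
  · rw [e₁, l₂, hN _ (by omega)]
  rw [l₃ _ e₁]
  by_cases e₂ : x = N
  · rw [e₂, k₂, hN _ le_rfl]; rfl
  exact k₅ x e₂ e₁ hx

theorem of_primrec' {n : ℕ} {f : List.Vector ℕ n → ℕ} (hf : Nat.Primrec' f) :
    ProgComputes f := by
  induction hf with
  | zero => exact zero
  | succ => exact succ
  | get i => exact get i
  | comp g _ _ ihf ihg => exact comp ihf ihg
  | prec _ _ ihf ihg => exact prec ihf ihg

end ProgComputes

/-! ### A finite counter machine with undecidable halting problem -/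

/-- The control-states that the program `p`, started with remaining programs `k`, can go through
before it reaches `k`. -/
def conts : Prog → List Prog → Set (List Prog)
  | .op r b, k => {.op r b :: k}
  | .seq p₁ p₂, k => {.seq p₁ p₂ :: k} ∪ (conts p₁ (p₂ :: k) ∪ conts p₂ k)
  | .while r p, k => {.while r p :: k} ∪ conts p (.while r p :: k)

theorem finite_conts : ∀ p k, (conts p k).Finite
  | .op _ _, _ => Set.finite_singleton _
  | .seq p₁ p₂, k => (Set.finite_singleton _).union
      ((finite_conts p₁ (p₂ :: k)).union (finite_conts p₂ k))
  | .while r p, k => (Set.finite_singleton _).union (finite_conts p (.while r p :: k))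

theorem cons_mem_conts (p : Prog) (k : List Prog) : p :: k ∈ conts p k := by
  cases p <;> simp [conts]

/-- `q'` is a possible successor of the control-state `q`. -/
def IsSucc {Q R : Type} (M : Q → Instr Q R) (q q' : Q) : Prop :=
  (∃ r b, M q = .op r b q') ∨ ∃ r q₁ q₀, M q = .test r q₁ q₀ ∧ (q' = q₁ ∨ q' = q₀)

theorem mem_conts_of_isSucc : ∀ (p : Prog) (k x y : List Prog), x ∈ conts p k →
    IsSucc progMachine x y → y ∈ conts p k ∨ y = k
  | .op r b, k, x, y, hx, hy => by
    obtain rfl : x = _ := hx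
    simp_all [IsSucc, progMachine]
  | .seq p₁ p₂, k, x, y, hx, hy => by
    rcases hx with rfl | hx | hx
    · have : y = p₁ :: p₂ :: k := by simpa [IsSucc, progMachine] using hy
      subst this
      exact .inl (.inr (.inl (cons_mem_conts _ _)))
    · rcases mem_conts_of_isSucc p₁ _ x y hx hy with h | rfl
      · exact .inl (.inr (.inl h))
      · exact .inl (.inr (.inr (cons_mem_conts _ _)))
    · rcases mem_conts_of_isSucc p₂ _ x y hx hy with h | rfl
      · exact .inl (.inr (.inr h))
      · exact .inr rfl
  | .while r p, k, x, y, hx, hy => by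
    rcases hx with rfl | hx
    · have : y = p :: .while r p :: k ∨ y = k := by simpa [IsSucc, progMachine] using hy
      rcases this with rfl | rfl
      · exact .inl (.inr (cons_mem_conts _ _))
      · exact .inr rfl
    · rcases mem_conts_of_isSucc p _ x y hx hy with h | rfl
      · exact .inl (.inr h)
      · exact .inl (.inl rfl)

/-- The register mentioned by an instruction (`0` for `halt`). -/
def Instr.reg {Q : Type} : Instr Q ℕ → ℕ
  | .op r _ _ => r
  | .test r _ _ => r
  | .halt => 0

/-- A structured program is run by a machine with finitely many control-states and registers. -/
theorem exists_finite_machine (p : Prog) : ∃ (Q R : Type) (_ : Fintype Q) (_ : Fintype R)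
    (_ : DecidableEq R) (M : Q → Instr Q R) (q₀ : Q) (r₀ : R), ∀ n : ℕ,
      Halts M q₀ (Function.update 0 r₀ (n : ℤ)) ↔
        Halts progMachine [p] (Function.update 0 0 (n : ℤ)) := by
  classical
  set S : Set (List Prog) := conts p [] ∪ {[]} with hS
  have hfin : S.Finite := (finite_conts p []).union (Set.finite_singleton _)
  have hsucc : ∀ x ∈ S, ∀ y, IsSucc progMachine x y → y ∈ S := by
    rintro x (hx | rfl) y hy
    · exact mem_conts_of_isSucc p [] x y hx hy
    · simp [IsSucc, progMachine] at hy
  have hp : [p] ∈ S := .inl (cons_mem_conts p [])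
  obtain ⟨K, hK⟩ := (hfin.image fun x => (progMachine x).reg).bddAbove
  replace hK : ∀ x ∈ S, (progMachine x).reg < K + 1 := fun x hx =>
    Nat.lt_succ_of_le (hK ⟨x, hx, rfl⟩)
  let f : List Prog → S := fun x => if h : x ∈ S then ⟨x, h⟩ else ⟨[p], hp⟩
  let g : ℕ → Fin (K + 1) := Fin.ofNat (K + 1)
  have hf : ∀ x ∈ S, (f x).1 = x := fun x hx => by simp [f, hx]
  have hg : Set.InjOn g (Set.Iio (K + 1)) := fun a ha b hb h => by
    have := congrArg Fin.val h
    simpa [g, Fin.ofNat, Nat.mod_eq_of_lt ha, Nat.mod_eq_of_lt hb] using this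
  refine ⟨S, Fin (K + 1), hfin.fintype, inferInstance, inferInstance,
    fun q => (progMachine q.1).map f g, f [p], g 0, fun n => ?_⟩
  refine halts_map_iff (S := S) (T := Set.Iio (K + 1)) hg (fun q hq => by rw [hf q hq])
    (fun q hq r b q' h => ⟨hsucc q hq _ (.inl ⟨r, b, h⟩), ?_⟩)
    (fun q hq r q₁ q₀ h => ⟨hsucc q hq _ (.inr ⟨r, q₁, q₀, h, .inl rfl⟩),
      hsucc q hq _ (.inr ⟨r, q₁, q₀, h, .inr rfl⟩), ?_⟩) hp (fun r hr => ?_)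
  · have := hK q hq
    rwa [h] at this
  · have := hK q hq
    rwa [h] at this
  · by_cases h : r = 0
    · simp [h]
    · have : g r ≠ g 0 := fun e => h (hg hr (Nat.succ_pos K) e)
      simp [h, this]

/-- Some structured program halts on input `n` in register `0` exactly if the `n`-th partial
recursive function is defined at `0`: it searches for a number of steps that suffices to compute
the value. -/
theorem exists_universal_prog : ∃ p : Prog, ∀ n : ℕ,
    Halts progMachine [p] (Function.update 0 0 (n : ℤ)) ↔
      (Nat.Partrec.Code.eval (Denumerable.ofNat Nat.Partrec.Code n) 0).Dom := by
  let g : List.Vector ℕ 2 → ℕ := fun v => bif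
    (Nat.Partrec.Code.evaln (v.get 1) (Denumerable.ofNat Nat.Partrec.Code (v.get 0)) 0).isSome
    then 0 else 1
  have hg : Primrec g := Primrec.cond
    (Primrec.option_isSome.comp (Nat.Partrec.Code.primrec_evaln.comp (Primrec.pair (Primrec.pair
      (Primrec.vector_get.comp .id (.const 1))
      ((Primrec.ofNat Nat.Partrec.Code).comp (Primrec.vector_get.comp .id (.const 0))))
      (.const 0)))) (.const 0) (.const 1)
  obtain ⟨p, hp⟩ := ProgComputes.of_primrec' (Nat.Primrec'.of_prim hg)
    (fun i => i.1) 2 3 (fun i => by omega) (by omega) (fun i => by omega)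
  let body : Prog := .seq (.op 2 false) (.seq p (.op 1 true))
  refine ⟨.seq (.op 2 true) (.while 2 body), fun n => ?_⟩
  -- The registers at the head of the search loop, for the bound `k` and the flag `a`.
  let st : ℕ → ℕ → ℕ → ℤ := fun k a r =>
    if r = 0 then n else if r = 1 then k else if r = 2 then a else 0
  have hbody : ∀ k, Exec body (st k 1) (st (k + 1) (g (n ::ᵥ k ::ᵥ .nil))) := fun k => by
    obtain ⟨t, h₁, h₂, h₃⟩ := hp (bump (st k 1) 2 false) (n ::ᵥ k ::ᵥ .nil)
      (Fin.cases (by simp [bump, st]) (Fin.cases (by simp [bump, st]; rfl) fun i => i.elim0))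
      (by simp [bump, st])
      (fun r hr => by
        have h0 : r ≠ 0 := by omega
        have h1 : r ≠ 1 := by omega
        have h2 : r ≠ 2 := by omega
        simp [bump, st, h0, h1, h2])
    have h := (Exec.op 2 false (st k 1)).seq (h₁.seq (Exec.op 1 true t))
    convert h using 1
    funext r
    by_cases h2 : r = 2
    · subst h2; simp [bump, h₂, st]
    by_cases h1 : r = 1
    · subst h1; simp [bump, h₃, st]
    simp [bump, h1, h2, h₃, st]
  have hstart : StateTransition.Reaches (machineStep progMachine)
      ([.seq (.op 2 true) (.while 2 body)], Function.update (0 : ℕ → ℤ) 0 (n : ℤ))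
      ([.while 2 body], st 0 1) := by
    refine .head (b := ([.op 2 true, .while 2 body], Function.update (0 : ℕ → ℤ) 0 (n : ℤ)))
      (by simp [machineStep, progMachine]) (.single ?_)
    simp only [machineStep, progMachine, Option.mem_def, Option.some.injEq, Prod.mk.injEq,
      true_and]
    funext r
    by_cases h2 : r = 2
    · subst h2; simp [bump, st]
    by_cases h1 : r = 0
    · subst h1; simp [bump, st]
    simp [bump, h1, h2, st]
  have hloop : ∀ k, StateTransition.Reaches₁ (machineStep progMachine)
      ([.while 2 body], st k 1) ([.while 2 body], st (k + 1) (g (n ::ᵥ k ::ᵥ .nil))) := fun k =>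
    .head (b := ([body, .while 2 body], st k 1)) (by simp [machineStep, progMachine, st])
      (hbody k _)
  have hgk : ∀ k, g (n ::ᵥ k ::ᵥ .nil) = bif
      (Nat.Partrec.Code.evaln k (Denumerable.ofNat Nat.Partrec.Code n) 0).isSome then 0 else 1 :=
    fun _ => rfl
  have hdom : (Nat.Partrec.Code.eval (Denumerable.ofNat Nat.Partrec.Code n) 0).Dom ↔
      ∃ k, g (n ::ᵥ k ::ᵥ .nil) = 0 := by
    simp only [Part.dom_iff_mem, Nat.Partrec.Code.evaln_complete, hgk, Bool.cond_eq_ite]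
    rw [exists_comm]
    simp [Option.isSome_iff_exists]
  rw [halts_of_reaches hstart, hdom]
  constructor
  · contrapose!
    intro hne
    have hone : ∀ k, g (n ::ᵥ k ::ᵥ .nil) = 1 := fun k => by
      have := hne k
      rw [hgk] at this ⊢
      generalize Option.isSome _ = b at this ⊢
      cases b <;> simp_all
    refine not_halts_of_recurrent (Set.range fun k => ([.while 2 body], st k 1)) ?_
      (Set.mem_range_self 0)
    rintro _ ⟨k, rfl⟩
    exact ⟨_, ⟨k + 1, rfl⟩, by simpa only [hone] using hloop k⟩
  · intro hex
    classical
    have hfind := Nat.find_spec hex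
    have hreach : ∀ k ≤ Nat.find hex, StateTransition.Reaches (machineStep progMachine)
        ([.while 2 body], st 0 1) ([.while 2 body], st k 1) := fun k => by
      induction k with
      | zero => exact fun _ => .refl
      | succ k ih =>
        intro hk
        have : g (n ::ᵥ k ::ᵥ .nil) = 1 := by
          have := Nat.find_min hex (m := k) (by omega)
          rw [hgk] at this ⊢
          generalize Option.isSome _ = b at this ⊢
          cases b <;> simp_all
        have h := hloop k
        rw [this] at h
        exact (ih (by omega)).trans h.to_reflTransGen
    have h := (hreach _ le_rfl).trans (hloop _).to_reflTransGen
    rw [hfind] at h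
    rw [halts_of_reaches h, halts_test (M := progMachine) (q := [.while 2 body]) (r := 2)
      (q₁ := [body, .while 2 body]) (q₀ := []) rfl]
    exact halts_halt (by simp [st, progMachine]) _

/-- There is a finite counter machine with undecidable halting problem. -/
theorem exists_undecidable_machine : ∃ (Q R : Type) (_ : Fintype Q) (_ : Fintype R)
    (_ : DecidableEq R) (M : Q → Instr Q R) (q₀ : Q) (r₀ : R),
      ¬ ComputablePred fun n : ℕ => Halts M q₀ (Function.update 0 r₀ (n : ℤ)) := by
  obtain ⟨p, hp⟩ := exists_universal_prog
  obtain ⟨Q, R, hQ, hR, hd, M, q₀, r₀, h⟩ := exists_finite_machine p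
  refine ⟨Q, R, hQ, hR, hd, M, q₀, r₀, fun hc => ComputablePred.halting_problem 0 ?_⟩
  simp only [h, hp] at hc
  obtain ⟨f, hf, hf'⟩ := ComputablePred.computable_iff.1 hc
  refine ComputablePred.computable_iff.2
    ⟨fun c => f (Encodable.encode c), hf.comp Computable.encode, ?_⟩
  funext c
  have := congrFun hf' (Encodable.encode c)
  simpa using this

/-! ### Pushdown energy games over arbitrary finite types -/

section Player1

variable {d : ℕ} {G : PushdownEnergyGame d}

/-- A strategy of Player 1 shifted by one move that has already been played. -/
def PushdownEnergyGame.Strategy1.shift (σ : G.Strategy1) (c : G.Config) : G.Strategy1 where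
  move h := σ.move (c :: h)
  legal h := σ.legal (c :: h)

theorem PushdownEnergyGame.Strategy1.follows_cons (σ : G.Strategy1) {c : G.Config}
    {ρ : ℕ → G.Config} (h₀ : G.OwnedByPlayer1 c → ρ 0 = σ.move [] c)
    (h : (σ.shift c).Follows ρ) : σ.Follows fun k => Nat.casesOn k c ρ := by
  rintro (_ | k) hk
  · exact h₀ hk
  · have := h k hk
    simpa [List.range_succ_eq_map, Function.comp_def, shift] using this

theorem PushdownEnergyGame.exists_play_follows (hG : G.Total) (σ : G.Strategy1) (c : G.Config) :
    ∃ ρ : ℕ → G.Config, ρ 0 = c ∧ G.IsPlay ρ ∧ σ.Follows ρ := by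
  classical
  choose next hnext using hG
  let step : List G.Config × G.Config → List G.Config × G.Config := fun x =>
    (x.1 ++ [x.2], if G.OwnedByPlayer1 x.2 then σ.move x.1 x.2 else next x.2)
  let run : ℕ → List G.Config × G.Config := fun k => step^[k] ([], c)
  have hrun : ∀ k, run (k + 1) = step (run k) := fun k => Function.iterate_succ_apply' _ _ _
  have hhist : ∀ k, (run k).1 = (List.range k).map fun i => (run i).2 := fun k => by
    induction k with
    | zero => rfl
    | succ k ih => rw [hrun, List.range_succ, List.map_append, ← ih]; rfl
  refine ⟨fun k => (run k).2, rfl, fun k => ?_, fun k hk => ?_⟩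
  · simp only [hrun, step]
    split_ifs with h
    · exact σ.legal _ _ h
    · exact hnext _
  · simp only at hk
    rw [← hhist]
    simp only [hrun, step, if_pos hk]

theorem PushdownEnergyGame.Player1Wins.energy_nonneg (hG : G.Total) {c : G.Config}
    (h : G.Player1Wins c) (i : Fin d) : 0 ≤ c.energy i := by
  obtain ⟨σ, hσ⟩ := h
  obtain ⟨ρ, h₀, h₁, h₂⟩ := G.exists_play_follows hG σ c
  simpa [h₀] using hσ ρ h₀ h₁ h₂ 0 i

theorem PushdownEnergyGame.Player1Wins.step {c : G.Config} (h : G.Player1Wins c)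
    (hc : ¬ G.OwnedByPlayer1 c) {c' : G.Config} (hs : G.Step c c') : G.Player1Wins c' := by
  obtain ⟨σ, hσ⟩ := h
  refine ⟨σ.shift c, fun ρ h₀ h₁ h₂ k i => ?_⟩
  refine hσ (fun k => Nat.casesOn k c ρ) rfl ?_
    (σ.follows_cons (fun h => absurd h hc) h₂) (k + 1) i
  rintro (_ | k)
  · simpa [h₀] using hs
  · exact h₁ k

theorem PushdownEnergyGame.Player1Wins.exists_step {c : G.Config} (h : G.Player1Wins c)
    (hc : G.OwnedByPlayer1 c) : ∃ c', G.Step c c' ∧ G.Player1Wins c' := by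
  obtain ⟨σ, hσ⟩ := h
  refine ⟨σ.move [] c, σ.legal _ _ hc, σ.shift c, fun ρ h₀ h₁ h₂ k i => ?_⟩
  refine hσ (fun k => Nat.casesOn k c ρ) rfl ?_
    (σ.follows_cons (fun _ => h₀) h₂) (k + 1) i
  rintro (_ | k)
  · simpa [h₀] using σ.legal [] c hc
  · exact h₁ k

/-- Player 1 wins from each configuration of a set in which the energy is never negative and in
which Player 1 can stay. -/
theorem PushdownEnergyGame.player1Wins_of_invariant (hG : G.Total) (W : Set G.Config)
    (hpos : ∀ c ∈ W, ∀ i, 0 ≤ c.energy i)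
    (h₀ : ∀ c ∈ W, ¬ G.OwnedByPlayer1 c → ∀ c', G.Step c c' → c' ∈ W)
    (h₁ : ∀ c ∈ W, G.OwnedByPlayer1 c → ∃ c', G.Step c c' ∧ c' ∈ W)
    {c : G.Config} (hc : c ∈ W) : G.Player1Wins c := by
  classical
  have hmove : ∀ c : G.Config, ∃ c', G.Step c c' ∧ (c ∈ W → G.OwnedByPlayer1 c → c' ∈ W) := by
    intro c
    by_cases h : c ∈ W ∧ G.OwnedByPlayer1 c
    · obtain ⟨c', hs, hw⟩ := h₁ c h.1 h.2
      exact ⟨c', hs, fun _ _ => hw⟩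
    · obtain ⟨c', hs⟩ := hG c
      exact ⟨c', hs, fun a b => absurd ⟨a, b⟩ h⟩
  choose next hstep hW using hmove
  refine ⟨⟨fun _ => next, fun _ c _ => hstep c⟩, fun ρ hρ hplay hfol k i => ?_⟩
  suffices h : ρ k ∈ W from hpos _ h i
  induction k with
  | zero => rwa [hρ]
  | succ k ih =>
    by_cases ho : G.OwnedByPlayer1 (ρ k)
    · rw [hfol k ho]; exact hW _ ih ho
    · exact h₀ _ ih ho _ (hplay k)

end Player1

section Arena

variable {S₀ S₁ Γ : Type} [Fintype S₀] [Fintype S₁] [Fintype Γ]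

/-- The moves of a pushdown energy game whose energy components always change by the same amount:
for each control-state and top symbol the list of triples of a new control-state, the word that
replaces the top symbol and the change of energy. -/
abbrev Arena (S₀ S₁ Γ : Type) : Type :=
  S₀ ⊕ S₁ → Γ → List ((S₀ ⊕ S₁) × List Γ × SignType)

namespace Arena

/-- The pushdown energy game of dimension `d` with the given moves. -/
noncomputable def game (A : Arena S₀ S₁ Γ) (d : ℕ) : PushdownEnergyGame d where
  numStates₀ := Fintype.card S₀
  numStates₁ := Fintype.card S₁
  numSymbols := Fintype.card Γ
  transitions := (Finset.univ : Finset ((S₀ ⊕ S₁) × Γ)).toList.flatMap fun a =>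
    (A a.1 a.2).map fun m =>
      (Sum.map (Fintype.equivFin S₀) (Fintype.equivFin S₁) a.1, Fintype.equivFin Γ a.2,
        Sum.map (Fintype.equivFin S₀) (Fintype.equivFin S₁) m.1,
        m.2.1.map (Fintype.equivFin Γ), fun _ => m.2.2)

/-- Numbering of the control-states. -/
noncomputable def encState (A : Arena S₀ S₁ Γ) (d : ℕ) : S₀ ⊕ S₁ ≃ (A.game d).State :=
  Equiv.sumCongr (Fintype.equivFin S₀) (Fintype.equivFin S₁)

/-- Numbering of the stack symbols. -/
noncomputable def encSymbol (A : Arena S₀ S₁ Γ) (d : ℕ) : Γ ≃ Fin (A.game d).numSymbols :=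
  Fintype.equivFin Γ

/-- The configuration of the game with control-state `s`, stack `l` and energies `v i + e`; the
offset `v` stays the same throughout a play. -/
noncomputable def config (A : Arena S₀ S₁ Γ) (d : ℕ) (v : Fin d → ℤ) (s : S₀ ⊕ S₁)
    (l : List Γ) (hl : l ≠ []) (e : ℤ) : (A.game d).Config where
  state := A.encState d s
  stack := l.map (A.encSymbol d)
  stack_ne := fun h => hl (List.map_eq_nil_iff.1 h)
  energy := fun i => v i + e

variable {A : Arena S₀ S₁ Γ} {d : ℕ} {v : Fin d → ℤ}

theorem mem_transitions {t} : t ∈ (A.game d).transitions ↔ ∃ s X, ∃ m ∈ A s X,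
    (A.encState d s, A.encSymbol d X, A.encState d m.1, m.2.1.map (A.encSymbol d),
      fun _ => m.2.2) = t := by
  refine List.mem_flatMap.trans ⟨fun ⟨a, _, h⟩ => ?_, fun ⟨s, X, m, hm, h⟩ => ?_⟩
  · obtain ⟨m, hm, h⟩ := List.mem_map.1 h
    exact ⟨a.1, a.2, m, hm, h⟩
  · exact ⟨(s, X), by simp, List.mem_map.2 ⟨m, hm, h⟩⟩

theorem step_config {s : S₀ ⊕ S₁} {X : Γ} {l : List Γ} {e : ℤ}
    {m : (S₀ ⊕ S₁) × List Γ × SignType} (hm : m ∈ A s X) (hl : m.2.1 ++ l ≠ []) :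
    (A.game d).Step (A.config d v s (X :: l) (List.cons_ne_nil _ _) e)
      (A.config d v m.1 (m.2.1 ++ l) hl (e + m.2.2)) :=
  ⟨A.encSymbol d X, l.map (A.encSymbol d), m.2.1.map (A.encSymbol d), fun _ => m.2.2,
    mem_transitions.2 ⟨s, X, m, hm, rfl⟩, rfl, List.map_append, fun i => (add_assoc (v i) e _).symm⟩

theorem exists_of_step_config {s : S₀ ⊕ S₁} {X : Γ} {l : List Γ} {e : ℤ} {c : (A.game d).Config}
    (h : (A.game d).Step (A.config d v s (X :: l) (List.cons_ne_nil _ _) e) c) :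
    ∃ m ∈ A s X, ∃ hl : m.2.1 ++ l ≠ [], c = A.config d v m.1 (m.2.1 ++ l) hl (e + m.2.2) := by
  obtain ⟨Y, α, β, C, ht, h₁, h₂, h₃⟩ := h
  obtain ⟨s', X', m, hm, heq⟩ := mem_transitions.1 ht
  obtain ⟨cs, cl, cne, ce⟩ := c
  obtain ⟨rfl, rfl⟩ := List.cons.inj h₁
  obtain ⟨hs, heq⟩ := Prod.mk.inj heq
  obtain ⟨hX, heq⟩ := Prod.mk.inj heq
  obtain ⟨hs', heq⟩ := Prod.mk.inj heq
  obtain ⟨rfl, rfl⟩ := Prod.mk.inj heq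
  change _ = cs at hs'
  subst hs'
  change cl = _ at h₂
  obtain rfl := (A.encState d).injective hs
  obtain rfl := (A.encSymbol d).injective hX
  erw [← List.map_append] at h₂
  subst h₂
  refine ⟨m, hm, by simpa using cne, ?_⟩
  simp only [config, PushdownEnergyGame.Config.mk.injEq, true_and]
  exact funext fun i => (h₃ i).trans (add_assoc (v i) e _)

theorem owned_config {s : S₀ ⊕ S₁} {l : List Γ} {hl : l ≠ []} {e : ℤ} :
    (A.game d).OwnedByPlayer1 (A.config d v s l hl e) ↔ s.isRight = true := by
  cases s <;> exact Iff.rfl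

theorem game_total (hA : ∀ s X, ∃ m ∈ A s X, m.2.1 ≠ []) (d : ℕ) : (A.game d).Total := by
  rintro ⟨s, l, hl, e⟩
  obtain ⟨Y, α, rfl⟩ := List.exists_cons_of_ne_nil hl
  obtain ⟨m, hm, hne⟩ := hA ((A.encState d).symm s) ((A.encSymbol d).symm Y)
  exact ⟨⟨A.encState d m.1, m.2.1.map (A.encSymbol d) ++ α, by simp [hne], fun i => e i + m.2.2⟩,
    Y, α, m.2.1.map (A.encSymbol d), fun _ => m.2.2,
    mem_transitions.2 ⟨_, _, m, hm, by simp only [Equiv.apply_symm_apply]⟩, rfl, rfl, fun _ => rfl⟩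

/-- Invariants of winning plays of Player 1, for games given by an arena. -/
theorem player1Wins_config (hA : ∀ s X, ∃ m ∈ A s X, m.2.1 ≠ [])
    (W : S₀ ⊕ S₁ → List Γ → ℤ → Prop) (hpos : ∀ s l e, W s l e → 0 ≤ e)
    (h₀ : ∀ s X l e, W (.inl s) (X :: l) e → ∀ m ∈ A (.inl s) X, m.2.1 ++ l ≠ [] →
      W m.1 (m.2.1 ++ l) (e + m.2.2))
    (h₁ : ∀ s X l e, W (.inr s) (X :: l) e → ∃ m ∈ A (.inr s) X, m.2.1 ++ l ≠ [] ∧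
      W m.1 (m.2.1 ++ l) (e + m.2.2))
    (hv : ∀ i, 0 ≤ v i) {s : S₀ ⊕ S₁} {l : List Γ} {e : ℤ} (hl : l ≠ []) (h : W s l e) :
    (A.game d).Player1Wins (A.config d v s l hl e) := by
  refine PushdownEnergyGame.player1Wins_of_invariant (game_total hA d)
    {c | ∃ s l hl e, W s l e ∧ c = A.config d v s l hl e} ?_ ?_ ?_ ⟨s, l, hl, e, h, rfl⟩
  · rintro _ ⟨s, l, hl, e, h, rfl⟩ i
    exact add_nonneg (hv i) (hpos s l e h)
  · rintro _ ⟨s, l, hl, e, h, rfl⟩ ho c' hc'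
    obtain ⟨X, l, rfl⟩ := List.exists_cons_of_ne_nil hl
    obtain ⟨m, hm, hne, rfl⟩ := exists_of_step_config hc'
    rw [owned_config] at ho
    obtain ⟨s, rfl⟩ : ∃ s', s = .inl s' := by cases s <;> simp_all
    exact ⟨_, _, hne, _, h₀ _ _ _ _ h m hm hne, rfl⟩
  · rintro _ ⟨s, l, hl, e, h, rfl⟩ ho
    obtain ⟨X, l, rfl⟩ := List.exists_cons_of_ne_nil hl
    rw [owned_config] at ho
    obtain ⟨s, rfl⟩ : ∃ s', s = .inr s' := by cases s <;> simp_all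
    obtain ⟨m, hm, hne, h⟩ := h₁ _ _ _ _ h
    exact ⟨_, step_config hm hne, _, _, hne, _, h, rfl⟩

/-- The configurations from which Player 0 can force the energy below zero. -/
inductive Lost (A : Arena S₀ S₁ Γ) : S₀ ⊕ S₁ → List Γ → ℤ → Prop
  | neg {s l e} (h : e < 0) : Lost A s l e
  | player0 {s X l e} (m) (hm : m ∈ A (.inl s) X) (hl : m.2.1 ++ l ≠ [])
      (h : Lost A m.1 (m.2.1 ++ l) (e + m.2.2)) : Lost A (.inl s) (X :: l) e
  | player1 {s X l e} (h : ∀ m ∈ A (.inr s) X, m.2.1 ++ l ≠ [] →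
      Lost A m.1 (m.2.1 ++ l) (e + m.2.2)) : Lost A (.inr s) (X :: l) e

theorem Lost.not_player1Wins (hA : ∀ s X, ∃ m ∈ A s X, m.2.1 ≠ []) {i : Fin d}
    (hv : v i ≤ 0) {s : S₀ ⊕ S₁} {l : List Γ} {e : ℤ} (h : Lost A s l e) (hl : l ≠ []) :
    ¬ (A.game d).Player1Wins (A.config d v s l hl e) := by
  induction h with
  | neg h =>
    exact fun hw => absurd (hw.energy_nonneg (game_total hA d) i)
      (not_le.2 (add_neg_of_nonpos_of_neg hv h))
  | player0 m hm hne _ ih =>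
    exact fun hw => ih hne (hw.step (by simp [owned_config]) (step_config hm hne))
  | player1 _ ih =>
    intro hw
    obtain ⟨c, hc, hw⟩ := hw.exists_step (by simp [owned_config])
    obtain ⟨m, hm, hne, rfl⟩ := exists_of_step_config hc
    exact ih m hm hne hne hw

end Arena

end Arena

/-! ### Histories of counter machines -/

section History

variable {R : Type} [DecidableEq R]

/-- The register contents after a history of increments and decrements, latest operation first. -/
def histVal : List (R × Bool) → R → ℤ
  | [] => 0
  | o :: l => bump (histVal l) o.1 o.2

/-- The history that loads `n` into the register `r`. -/
def inputHist (r : R) (n : ℕ) : List (R × Bool) := List.replicate n (r, true)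

theorem histVal_inputHist (r : R) : ∀ n : ℕ,
    histVal (inputHist r n) = Function.update (0 : R → ℤ) r (n : ℤ)
  | 0 => by simp [inputHist, histVal]
  | n + 1 => by
    have ih := histVal_inputHist r n
    simp only [inputHist, List.replicate_succ, histVal] at ih ⊢
    rw [ih]
    simp [bump]

/-- What it costs to pop an operation when the claim "register `r` is positive" (`b = true`) or
"register `r` is not positive" (`b = false`) is tested against the history: `1` plus the effect of
the operation on `r` in the first case, `1` minus this effect in the second. If the energy is the
length of the history, then after popping all of it minus the contents of `r`, respectively the
contents of `r`, is left. As no cost is negative, the energy stays nonnegative on the way if the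
final energy is nonnegative. -/
def cost (r : R) (b : Bool) (o : R × Bool) : ℕ :=
  if o.1 = r then (if o.2 = b then 2 else 0) else 1

/-- The total cost of a history. -/
def histCost (r : R) (b : Bool) (l : List (R × Bool)) : ℕ := (l.map (cost r b)).sum

theorem histCost_cons (r : R) (b : Bool) (o : R × Bool) (l : List (R × Bool)) :
    histCost r b (o :: l) = cost r b o + histCost r b l := by simp [histCost]

theorem histCost_eq (r : R) (b : Bool) : ∀ l : List (R × Bool),
    (histCost r b l : ℤ) = l.length + (if b then histVal l r else - histVal l r)
  | [] => by simp [histCost, histVal]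
  | (r', b') :: l => by
    have ih := histCost_eq r b l
    rw [histCost_cons]
    push_cast
    rw [ih]
    by_cases h : r' = r
    · subst h
      cases b <;> cases b' <;> simp [cost, histVal, bump] <;> ring
    · have h' : r ≠ r' := fun e => h e.symm
      cases b <;> simp [cost, histVal, bump, h, h'] <;> ring

/-- The costs are paid in two steps of at most `1` each. -/
def costStep (r : R) (b : Bool) (o : R × Bool) (phase : Bool) : SignType :=
  if (if phase then 2 else 1) ≤ cost r b o then -1 else 0

theorem costStep_add (r : R) (b : Bool) (o : R × Bool) :
    ((costStep r b o false : SignType) : ℤ) + (costStep r b o true : SignType) = - cost r b o := by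
  unfold costStep cost
  split_ifs <;> simp_all

theorem costStep_nonpos (r : R) (b : Bool) (o : R × Bool) (p : Bool) :
    ((costStep r b o p : SignType) : ℤ) ≤ 0 := by
  unfold costStep
  split_ifs <;> simp

end History

/-! ### The energy game of a counter machine -/

/-- Control-states of Player 0 in the game of a counter machine. -/
inductive RunState (Q R : Type) : Type
  /-- the machine is in control-state `q` -/
  | run (q : Q)
  /-- the history is popped in order to test a claim about the register `r` -/
  | pop (r : R) (b : Bool) (phase : Bool)
  /-- the stack is empty and the input has to be provided -/
  | restart
  /-- the credit for the input is collected -/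
  | load
  /-- the machine has halted and Player 1 loses -/
  | drain
  /-- Player 0 has given up -/
  | win
  deriving Fintype

/-- Control-states of Player 1: the claim about register `r` has been made, and the machine will
continue in control-state `q` if Player 1 accepts it. -/
inductive JudgeState (Q R : Type) : Type
  | judge (r : R) (b : Bool) (q : Q)
  deriving Fintype

/-- Stack symbols: the operations in the history and the bottom symbol `none`. -/
abbrev HistSymbol (R : Type) : Type := Option (R × Bool)

/-- The stack that contains the given history. -/
def histStack {R : Type} (l : List (R × Bool)) : List (HistSymbol R) := l.map some ++ [none]

theorem histStack_cons {R : Type} (o : R × Bool) (l : List (R × Bool)) :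
    histStack (o :: l) = some o :: histStack l := rfl

section Game

variable {Q R : Type} [DecidableEq R]

/-- The moves of the game of the counter machine `M` with input `n` in register `r₀`. Player 0 can
always give up by moving to `win`: popping a stack of height `1` is not a move, so without this
option some (unreachable) configurations would have no outgoing edge. Challenging the claim that a
register is not positive costs `1`, so that the test leaves nonnegative energy only if the register
contains at least `1`. After a test the stack is empty up to the bottom symbol; since a transition
can change the energy by at most `1`, the credit `n` for the input is collected by popping one copy
of the input before a second copy is pushed as the initial history. -/
def machineArena (M : Q → Instr Q R) (q₀ : Q) (r₀ : R) (n : ℕ) :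
    Arena (RunState Q R) (JudgeState Q R) (HistSymbol R)
  | .inl (.run q), X => (.inl .win, [X], 0) :: match M q with
    | .op r b q' => [(.inl (.run q'), [some (r, b), X], 1)]
    | .test r q₁ q₀ =>
      [(.inr (.judge r true q₁), [X], 0), (.inr (.judge r false q₀), [X], 0)]
    | .halt => [(.inl .drain, [X], 0)]
  | .inl (.pop r b false), some o =>
    [(.inl .win, [some o], 0), (.inl (.pop r b true), [some o], costStep r b o false)]
  | .inl (.pop r b true), some o =>
    [(.inl .win, [some o], 0), (.inl (.pop r b false), [], costStep r b o true)]
  | .inl (.pop _ _ _), none => [(.inl .win, [none], 0), (.inl .restart, [none], 0)]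
  | .inl .restart, some o => [(.inl .win, [some o], 0)]
  | .inl .restart, none =>
    [(.inl .win, [none], 0), (.inl .load, histStack (inputHist r₀ n), 0)]
  | .inl .load, some o => [(.inl .win, [some o], 0), (.inl .load, [], 1)]
  | .inl .load, none =>
    [(.inl .win, [none], 0), (.inl (.run q₀), histStack (inputHist r₀ n), 0)]
  | .inl .drain, X => [(.inl .win, [X], 0), (.inl .drain, [X], -1)]
  | .inl .win, X => [(.inl .win, [X], 0)]
  | .inr (.judge r b q), X =>
    [(.inl (.run q), [X], 0), (.inl (.pop r b false), [X], if b then 0 else -1)]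

theorem machineArena_total (M : Q → Instr Q R) (q₀ : Q) (r₀ : R) (n : ℕ) (s X) :
    ∃ m ∈ machineArena M q₀ r₀ n s X, m.2.1 ≠ [] := by
  rcases s with (q | ⟨r, b, _ | _⟩ | _ | _ | _ | _) | ⟨r, b, q⟩ <;> rcases X with _ | o <;>
    simp [machineArena]

/-- The positions of the game from which Player 1 wins if the machine does not halt: the energy is
at least the length of a history, and pays for a test that is under way. -/
inductive Safe (M : Q → Instr Q R) (q₀ : Q) (r₀ : R) (n : ℕ) :
    RunState Q R ⊕ JudgeState Q R → List (HistSymbol R) → ℤ → Prop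
  | run {q l e} (hM : ¬ Halts M q (histVal l)) (he : (l.length : ℤ) ≤ e) :
      Safe M q₀ r₀ n (.inl (.run q)) (histStack l) e
  | judge {r b q l e} (hM : (b = true ↔ 1 ≤ histVal l r) → ¬ Halts M q (histVal l))
      (he : (l.length : ℤ) ≤ e) :
      Safe M q₀ r₀ n (.inr (.judge r b q)) (histStack l) e
  | pop {r b l e} (he : (histCost r b l : ℤ) ≤ e) :
      Safe M q₀ r₀ n (.inl (.pop r b false)) (histStack l) e
  | pop' {r b o l e} (he : -(costStep r b o true : ℤ) + histCost r b l ≤ e) :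
      Safe M q₀ r₀ n (.inl (.pop r b true)) (some o :: histStack l) e
  | restart {e} (he : 0 ≤ e) : Safe M q₀ r₀ n (.inl .restart) [none] e
  | load {k : ℕ} {e : ℤ} (he : (n : ℤ) ≤ e + k) (he₀ : 0 ≤ e) :
      Safe M q₀ r₀ n (.inl .load) (histStack (inputHist r₀ k)) e
  | win {l e} (he : 0 ≤ e) : Safe M q₀ r₀ n (.inl .win) l e

theorem Safe.nonneg {M : Q → Instr Q R} {q₀ : Q} {r₀ : R} {n : ℕ} {s l e}
    (h : Safe M q₀ r₀ n s l e) : 0 ≤ e := by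
  cases h with
  | run _ he => omega
  | judge _ he => omega
  | pop he => omega
  | @pop' r b o l e he => have := costStep_nonpos r b o true; omega
  | restart he => exact he
  | load _ he => exact he
  | win he => exact he

/-- If the machine does not halt, Player 1 stays in safe positions by challenging exactly the false
claims. -/
theorem player1Wins_of_not_halts [Fintype Q] [Fintype R] {M : Q → Instr Q R} {q₀ : Q} {r₀ : R}
    {n : ℕ} (hM : ¬ Halts M q₀ (Function.update 0 r₀ (n : ℤ))) (d : ℕ) :
    ((machineArena M q₀ r₀ n).game d).Player1Wins
      ((machineArena M q₀ r₀ n).config d 0 (.inl .restart) [none] (List.cons_ne_nil _ _) 0) := by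
  refine Arena.player1Wins_config (machineArena_total M q₀ r₀ n) (Safe M q₀ r₀ n)
    (fun _ _ _ h => h.nonneg) ?_ ?_ (fun _ => le_rfl) _ (.restart le_rfl)
  · intro s X l e h m hm _
    have hwin : m = (.inl .win, [X], 0) → Safe M q₀ r₀ n m.1 (m.2.1 ++ l) (e + m.2.2) := by
      rintro rfl
      exact .win (by simpa using h.nonneg)
    generalize hs : Sum.inl s = s' at h
    generalize hl : X :: l = l' at h
    cases h with
    | @run q l₁ e hM he =>
      obtain rfl := Sum.inl.inj hs
      simp only [machineArena, List.mem_cons] at hm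
      rcases hm with hm | hm
      · exact hwin hm
      match hi : M q with
      | .op r b q' =>
        rw [hi] at hm
        obtain rfl := List.mem_singleton.1 hm
        rw [halts_op hi] at hM
        have := Safe.run (q₀ := q₀) (r₀ := r₀) (n := n) (l := (r, b) :: l₁) (e := e + 1) hM
          (by simpa using he)
        simpa [histStack_cons, ← hl] using this
      | .test r q₁ q₂ =>
        rw [hi] at hm
        rw [halts_test hi] at hM
        simp only [List.mem_cons, List.not_mem_nil, or_false] at hm
        rcases hm with rfl | rfl
        · have := Safe.judge (q₀ := q₀) (r₀ := r₀) (n := n) (r := r) (b := true) (q := q₁)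
            (l := l₁) (e := e) (fun h => by simpa [h.1 rfl] using hM) he
          simpa [← hl] using this
        · have := Safe.judge (q₀ := q₀) (r₀ := r₀) (n := n) (r := r) (b := false) (q := q₂)
            (l := l₁) (e := e) (fun h => by simpa [show ¬ 1 ≤ histVal l₁ r by simpa using h]
              using hM) he
          simpa [← hl] using this
      | .halt => exact absurd (halts_halt hi _) hM
    | judge => cases hs
    | @pop r b l₁ e he =>
      obtain rfl := Sum.inl.inj hs
      cases l₁ with
      | nil =>
        obtain ⟨rfl, rfl⟩ := List.cons.inj hl
        simp only [machineArena, List.mem_cons, List.not_mem_nil, or_false] at hm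
        rcases hm with hm | rfl
        · exact hwin hm
        · exact .restart (by simp at he ⊢; omega)
      | cons o l₁ =>
        obtain ⟨rfl, rfl⟩ := List.cons.inj hl
        simp only [machineArena, List.mem_cons, List.not_mem_nil, or_false] at hm
        rcases hm with hm | rfl
        · exact hwin hm
        · have := costStep_add r b o
          rw [histCost_cons] at he
          push_cast at he
          exact .pop' (by simp only; omega)
    | @pop' r b o l₁ e he =>
      obtain rfl := Sum.inl.inj hs
      obtain ⟨rfl, rfl⟩ := List.cons.inj hl
      simp only [machineArena, List.mem_cons, List.not_mem_nil, or_false] at hm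
      rcases hm with hm | rfl
      · exact hwin hm
      · exact .pop (by simp only; omega)
    | restart he =>
      obtain rfl := Sum.inl.inj hs
      obtain ⟨rfl, rfl⟩ := List.cons.inj hl
      simp only [machineArena, List.mem_cons, List.not_mem_nil, or_false] at hm
      rcases hm with hm | rfl
      · exact hwin hm
      · simpa using Safe.load (M := M) (q₀ := q₀) (r₀ := r₀) (n := n) (k := n) (e := e)
          (by omega) he
    | @load k e he he₀ =>
      obtain rfl := Sum.inl.inj hs
      cases k with
      | zero =>
        obtain ⟨rfl, rfl⟩ := List.cons.inj hl
        simp only [machineArena, List.mem_cons, List.not_mem_nil, or_false] at hm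
        rcases hm with hm | rfl
        · exact hwin hm
        · rw [← histVal_inputHist] at hM
          simpa using Safe.run (q₀ := q₀) (r₀ := r₀) (n := n) (e := e) hM
            (by simpa [inputHist] using he)
      | succ k =>
        obtain ⟨rfl, rfl⟩ := List.cons.inj hl
        simp only [machineArena, List.mem_cons, List.not_mem_nil, or_false] at hm
        rcases hm with hm | rfl
        · exact hwin hm
        · exact Safe.load (k := k) (by push_cast at he; simp; omega) (by simp; omega)
    | win he =>
      obtain rfl := Sum.inl.inj hs
      simp only [machineArena, List.mem_singleton] at hm
      exact hwin hm
  · intro s X l e h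
    generalize hs : Sum.inr s = s' at h
    generalize hl : X :: l = l' at h
    cases h with
    | @judge r b q l₁ e hM he =>
      obtain rfl := Sum.inr.inj hs
      by_cases hb : b = true ↔ 1 ≤ histVal l₁ r
      · refine ⟨(.inl (.run q), [X], 0), by simp [machineArena], by simp, ?_⟩
        simpa [hl] using Safe.run (q₀ := q₀) (r₀ := r₀) (n := n) (hM hb) he
      · refine ⟨(.inl (.pop r b false), [X], if b then 0 else -1), by simp [machineArena],
          by simp, ?_⟩
        simp only [List.singleton_append, hl]
        refine .pop ?_
        rw [histCost_eq]
        cases b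
        · have : 1 ≤ histVal l₁ r := by simpa using hb
          simp
          omega
        · have : ¬ 1 ≤ histVal l₁ r := by simpa using hb
          simp
          omega
    | _ => cases hs

section Lost

open Arena

variable {M : Q → Instr Q R} {q₀ : Q} {r₀ : R} {n : ℕ}

theorem lost_drain (X : HistSymbol R) (l : List (HistSymbol R)) (m : ℕ) : ∀ e : ℤ, e < m →
    Lost (machineArena M q₀ r₀ n) (.inl .drain) (X :: l) e := by
  induction m with
  | zero => exact fun e he => .neg (by simpa using he)
  | succ m ih =>
    intro e he
    refine .player0 (.inl .drain, [X], -1) (by simp [machineArena]) (by simp) ?_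
    exact ih _ (by push_cast at he; simp; omega)

/-- A test leads to a restart with the energy reduced by the cost of the history. -/
theorem lost_pop (r : R) (b : Bool) : ∀ (l : List (R × Bool)) (e : ℤ),
    Lost (machineArena M q₀ r₀ n) (.inl .restart) [none] (e - histCost r b l) →
    Lost (machineArena M q₀ r₀ n) (.inl (.pop r b false)) (histStack l) e
  | [], e, h => .player0 (.inl .restart, [none], 0) (by simp [machineArena]) (by simp)
      (by simpa [histCost] using h)
  | o :: l, e, h => by
    refine .player0 (.inl (.pop r b true), [some o], costStep r b o false) (by simp [machineArena])
      (by simp) ?_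
    refine .player0 (.inl (.pop r b false), [], costStep r b o true) (by simp [machineArena])
      (by simp) ?_
    refine lost_pop r b l _ ?_
    have := costStep_add r b o
    rw [histCost_cons] at h
    convert h using 1
    push_cast
    omega

/-- If the machine halts and all restarts with less energy are lost for Player 1, then so is every
position on the run: Player 0 makes true claims, and a wrong challenge costs energy. -/
theorem lost_run (E : ℤ)
    (hE : ∀ e < E, Lost (machineArena M q₀ r₀ n) (.inl .restart) [none] e) {q : Q} {s : R → ℤ}
    (h : Halts M q s) : ∀ l : List (R × Bool), histVal l = s →
      Lost (machineArena M q₀ r₀ n) (.inl (.run q)) (histStack l) (E + l.length) := by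
  have hcons : ∀ l : List (R × Bool), ∃ X l', histStack l = X :: l' := fun l =>
    List.exists_cons_of_ne_nil (by simp [histStack])
  refine Halts.induction (P := fun q s => ∀ l : List (R × Bool), histVal l = s →
      Lost (machineArena M q₀ r₀ n) (.inl (.run q)) (histStack l) (E + l.length))
    (fun q s hi => ?_) (fun q s r b q' hi ih => ?_) (fun q s r q₁ q₂ hi ih => ?_) h
  · rintro l -
    obtain ⟨X, l', hl⟩ := hcons l
    rw [hl]
    refine .player0 (.inl .drain, [X], 0) (by simp [machineArena, hi]) (by simp) ?_
    exact lost_drain _ _ (E + l.length + 1).toNat _ (by simp)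
  · rintro l rfl
    have := ih ((r, b) :: l) rfl
    rw [histStack_cons] at this
    obtain ⟨X, l', hl⟩ := hcons l
    rw [hl] at this ⊢
    refine .player0 (.inl (.run q'), [some (r, b), X], 1) (by simp [machineArena, hi]) (by simp) ?_
    simpa [add_assoc] using this
  · rintro l rfl
    have key : ∀ b q', (b = true ↔ 1 ≤ histVal l r) →
        Lost (machineArena M q₀ r₀ n) (.inl (.run q')) (histStack l) (E + l.length) →
        Lost (machineArena M q₀ r₀ n) (.inr (.judge r b q')) (histStack l) (E + l.length) := by
      intro b q' hb h
      have hpop : Lost (machineArena M q₀ r₀ n) (.inl (.pop r b false)) (histStack l)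
          (E + l.length + (if b then 0 else -1)) := by
        refine lost_pop r b l _ (hE _ ?_)
        rw [histCost_eq]
        cases b
        · have : ¬ 1 ≤ histVal l r := by simpa using hb
          simp
          omega
        · have : 1 ≤ histVal l r := by simpa using hb
          simp
          omega
      obtain ⟨X, l', hl⟩ := hcons l
      rw [hl] at h hpop ⊢
      refine .player1 fun m hm _ => ?_
      simp only [machineArena, List.mem_cons, List.not_mem_nil, or_false] at hm
      rcases hm with rfl | rfl
      · simpa using h
      · cases b <;> simpa using hpop
    have ih := ih l rfl
    obtain ⟨X, l', hl⟩ := hcons l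
    by_cases hr : 1 ≤ histVal l r
    · rw [if_pos hr] at ih
      have := key true q₁ (by simp [hr]) ih
      rw [hl] at this ⊢
      exact .player0 (.inr (.judge r true q₁), [X], 0) (by simp [machineArena, hi]) (by simp)
        (by simpa using this)
    · rw [if_neg hr] at ih
      have := key false q₂ (by simp [hr]) ih
      rw [hl] at this ⊢
      exact .player0 (.inr (.judge r false q₂), [X], 0) (by simp [machineArena, hi]) (by simp)
        (by simpa using this)

theorem lost_load (k : ℕ) : ∀ e : ℤ,
    Lost (machineArena M q₀ r₀ n) (.inl (.run q₀)) (histStack (inputHist r₀ n)) (e + k) →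
    Lost (machineArena M q₀ r₀ n) (.inl .load) (histStack (inputHist r₀ k)) e := by
  induction k with
  | zero =>
    intro e h
    refine .player0 (.inl (.run q₀), histStack (inputHist r₀ n), 0) (by simp [machineArena])
      (by simp [histStack]) ?_
    simpa using h
  | succ k ih =>
    intro e h
    refine .player0 (.inl .load, [], 1) (by simp [machineArena]) (by simp) ?_
    refine ih _ ?_
    push_cast at h
    convert h using 1
    simp
    ring

/-- If the machine halts, Player 1 loses with every initial energy, by induction on the energy: each
wrong challenge leads to a restart with less of it. -/
theorem lost_restart (hM : Halts M q₀ (Function.update 0 r₀ (n : ℤ))) (m : ℕ) : ∀ e : ℤ, e < m →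
    Lost (machineArena M q₀ r₀ n) (.inl .restart) [none] e := by
  induction m with
  | zero => exact fun e he => .neg (by simpa using he)
  | succ m ih =>
    intro e he
    refine .player0 (.inl .load, histStack (inputHist r₀ n), 0) (by simp [machineArena])
      (by simp [histStack]) ?_
    have h := lost_run e (fun e' he' => ih e' (by push_cast at he; omega)) hM (inputHist r₀ n)
      (histVal_inputHist r₀ n)
    have := lost_load n e (by simpa [inputHist] using h)
    simpa using this

end Lost

end Game

/-! ### Simulation over arbitrary finite types -/

section Encoding

variable {S Γ T L : Type} [Fintype S] [Fintype Γ] [Fintype T] [Fintype L]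

/-- The pushdown automaton whose transitions are listed for each control-state and top symbol. -/
noncomputable def pdaOf (P : S → Γ → List (L × S × List Γ)) :
    PushdownAutomaton (Fintype.card L) where
  numStates := Fintype.card S
  numSymbols := Fintype.card Γ
  transitions := (Finset.univ : Finset (S × Γ)).toList.flatMap fun a =>
    (P a.1 a.2).map fun m =>
      (Fintype.equivFin S a.1, Fintype.equivFin Γ a.2, Fintype.equivFin L m.1,
        Fintype.equivFin S m.2.1, m.2.2.map (Fintype.equivFin Γ))

/-- The one-counter net whose transitions are listed for each control-state and action. -/
noncomputable def netOf (V : T → L → List (T × SignType)) : VASS (Fintype.card L) 1 where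
  numStates := Fintype.card T
  transitions := (Finset.univ : Finset (T × L)).toList.flatMap fun a =>
    (V a.1 a.2).map fun m =>
      (Fintype.equivFin T a.1, Fintype.equivFin L a.2, Fintype.equivFin T m.1, fun _ => m.2)

variable (P : S → Γ → List (L × S × List Γ)) (V : T → L → List (T × SignType))

/-- Numbering of the control-states of the pushdown automaton. -/
noncomputable def pdaState : S ≃ Fin (pdaOf P).numStates := Fintype.equivFin S

/-- Numbering of the stack symbols of the pushdown automaton. -/
noncomputable def pdaSymbol : Γ ≃ Fin (pdaOf P).numSymbols := Fintype.equivFin Γ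

/-- Numbering of the control-states of the net. -/
noncomputable def netState : T ≃ Fin (netOf V).numStates := Fintype.equivFin T

/-- The configuration of the pushdown automaton with control-state `s` and stack `l`. -/
noncomputable def pdaConfig (s : S) (l : List Γ) (hl : l ≠ []) : (pdaOf P).Config where
  state := pdaState P s
  stack := l.map (pdaSymbol P)
  stack_ne := fun h => hl (List.map_eq_nil_iff.1 h)

/-- The configuration of the net with control-state `t` and counter `m`. -/
noncomputable def netConfig (t : T) (m : ℕ) : (netOf V).Config where
  state := netState V t
  counters := fun _ => m

variable {P V}

theorem mem_pdaOf_transitions {x} : x ∈ (pdaOf P).transitions ↔ ∃ s X, ∃ m ∈ P s X,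
    (pdaState P s, pdaSymbol P X, Fintype.equivFin L m.1, pdaState P m.2.1,
      m.2.2.map (pdaSymbol P)) = x := by
  refine List.mem_flatMap.trans ⟨fun ⟨a, _, h⟩ => ?_, fun ⟨s, X, m, hm, h⟩ => ?_⟩
  · obtain ⟨m, hm, h⟩ := List.mem_map.1 h
    exact ⟨a.1, a.2, m, hm, h⟩
  · exact ⟨(s, X), by simp, List.mem_map.2 ⟨m, hm, h⟩⟩

theorem mem_netOf_transitions {x} : x ∈ (netOf V).transitions ↔ ∃ t a, ∃ m ∈ V t a,
    (netState V t, Fintype.equivFin L a, netState V m.1, fun _ => m.2) = x := by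
  refine List.mem_flatMap.trans ⟨fun ⟨a, _, h⟩ => ?_, fun ⟨s, X, m, hm, h⟩ => ?_⟩
  · obtain ⟨m, hm, h⟩ := List.mem_map.1 h
    exact ⟨a.1, a.2, m, hm, h⟩
  · exact ⟨(s, X), by simp, List.mem_map.2 ⟨m, hm, h⟩⟩

theorem pda_step {s : S} {X : Γ} {l : List Γ} {m : L × S × List Γ} (hm : m ∈ P s X)
    (hl : m.2.2 ++ l ≠ []) :
    (pdaOf P).Step (pdaConfig P s (X :: l) (List.cons_ne_nil _ _)) (Fintype.equivFin L m.1)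
      (pdaConfig P m.2.1 (m.2.2 ++ l) hl) :=
  ⟨pdaSymbol P X, l.map (pdaSymbol P), m.2.2.map (pdaSymbol P),
    mem_pdaOf_transitions.2 ⟨s, X, m, hm, rfl⟩, rfl, List.map_append⟩

theorem exists_of_pda_step {s : S} {X : Γ} {l : List Γ} {a} {c : (pdaOf P).Config}
    (h : (pdaOf P).Step (pdaConfig P s (X :: l) (List.cons_ne_nil _ _)) a c) :
    ∃ m ∈ P s X, ∃ hl : m.2.2 ++ l ≠ [], a = Fintype.equivFin L m.1 ∧
      c = pdaConfig P m.2.1 (m.2.2 ++ l) hl := by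
  obtain ⟨Y, α, β, ht, h₁, h₂⟩ := h
  obtain ⟨s', X', m, hm, heq⟩ := mem_pdaOf_transitions.1 ht
  obtain ⟨cs, cl, cne⟩ := c
  obtain ⟨rfl, rfl⟩ := List.cons.inj h₁
  obtain ⟨hs, heq⟩ := Prod.mk.inj heq
  obtain ⟨hX, heq⟩ := Prod.mk.inj heq
  obtain ⟨ha, heq⟩ := Prod.mk.inj heq
  obtain ⟨hs', rfl⟩ := Prod.mk.inj heq
  change _ = cs at hs'
  subst hs'
  change cl = _ at h₂
  obtain rfl := (pdaState P).injective hs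
  obtain rfl := (pdaSymbol P).injective hX
  erw [← List.map_append] at h₂
  subst h₂
  exact ⟨m, hm, by simpa using cne, ha.symm, rfl⟩

theorem net_step {t : T} {a : L} {m m' : ℕ} {x : T × SignType} (hx : x ∈ V t a)
    (hm : (m' : ℤ) = m + x.2) :
    (netOf V).Step (netConfig V t m) (Fintype.equivFin L a) (netConfig V x.1 m') :=
  ⟨fun _ => x.2, mem_netOf_transitions.2 ⟨t, a, x, hx, rfl⟩, fun _ => hm⟩

theorem exists_of_net_step {t : T} {a : L} {m : ℕ} {c : (netOf V).Config}
    (h : (netOf V).Step (netConfig V t m) (Fintype.equivFin L a) c) :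
    ∃ x ∈ V t a, ∃ m' : ℕ, (m' : ℤ) = m + x.2 ∧ c = netConfig V x.1 m' := by
  obtain ⟨D, ht, h⟩ := h
  obtain ⟨t', a', x, hx, heq⟩ := mem_netOf_transitions.1 ht
  obtain ⟨cs, cc⟩ := c
  obtain ⟨hs, heq⟩ := Prod.mk.inj heq
  obtain ⟨ha, heq⟩ := Prod.mk.inj heq
  obtain ⟨hs', rfl⟩ := Prod.mk.inj heq
  change _ = cs at hs'
  subst hs'
  obtain rfl := (netState V).injective hs
  obtain rfl := (Fintype.equivFin L).injective ha
  refine ⟨x, hx, cc 0, h 0, ?_⟩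
  simp only [netConfig, VASS.Config.mk.injEq, true_and]
  exact funext fun i => by rw [Subsingleton.elim i 0]

/-- Simulations between automata given by lists of moves. -/
theorem simulatedBy_of_invariant (W : S → List Γ → T → ℕ → Prop)
    (hW : ∀ s X l t m, W s (X :: l) t m → ∀ x ∈ P s X, x.2.2 ++ l ≠ [] →
      ∃ y ∈ V t x.1, ∃ m' : ℕ, (m' : ℤ) = m + y.2 ∧ W x.2.1 (x.2.2 ++ l) y.1 m')
    {s : S} {l : List Γ} {t : T} {m : ℕ} (hl : l ≠ []) (h : W s l t m) :
    SimulatedBy (pdaOf P).Step (netOf V).Step (pdaConfig P s l hl) (netConfig V t m) := by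
  refine ⟨fun c c' => ∃ s l hl t m, W s l t m ∧ c = pdaConfig P s l hl ∧ c' = netConfig V t m, ?_,
    s, l, hl, t, m, h, rfl, rfl⟩
  rintro _ _ ⟨s, l, hl, t, m, h, rfl, rfl⟩ a c hc
  obtain ⟨X, l, rfl⟩ := List.exists_cons_of_ne_nil hl
  obtain ⟨x, hx, hne, rfl, rfl⟩ := exists_of_pda_step hc
  obtain ⟨y, hy, m', hm, h⟩ := hW s X l t m h x hx hne
  exact ⟨_, net_step hy hm, _, _, hne, _, _, h, rfl, rfl⟩

/-- The pairs of configurations for which the net can be forced, in finitely many rounds, into a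
configuration in which it cannot match a step of the pushdown automaton. -/
inductive Unmatched (P : S → Γ → List (L × S × List Γ)) (V : T → L → List (T × SignType)) :
    S → List Γ → T → ℕ → Prop
  | step {s X l t} {m : ℕ} (x) (hx : x ∈ P s X) (hl : x.2.2 ++ l ≠ [])
      (h : ∀ y ∈ V t x.1, ∀ m' : ℕ, (m' : ℤ) = m + y.2 →
        Unmatched P V x.2.1 (x.2.2 ++ l) y.1 m') :
      Unmatched P V s (X :: l) t m

theorem Unmatched.not_simulatedBy {s : S} {l : List Γ} {t : T} {m : ℕ} (h : Unmatched P V s l t m)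
    (hl : l ≠ []) :
    ¬ SimulatedBy (pdaOf P).Step (netOf V).Step (pdaConfig P s l hl) (netConfig V t m) := by
  rintro ⟨r, hr, hst⟩
  induction h with
  | step x hx hne _ ih =>
    obtain ⟨c, hc, hrc⟩ := hr _ _ hst _ _ (pda_step hx hne)
    obtain ⟨y, hy, m', hm, rfl⟩ := exists_of_net_step hc
    exact ih y hy m' hm hne hrc

end Encoding

/-! ### The simulation problem of a counter machine -/

/-- Actions of the automata for a counter machine with registers `R`. -/
inductive RunAction (R : Type) : Type
  /-- an operation is appended to the history -/
  | tick
  /-- a claim about the register `r` is made -/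
  | claim (r : R) (b : Bool)
  /-- the operation `o` is popped, in two phases -/
  | pop (o : R × Bool) (phase : Bool)
  /-- the machine has halted -/
  | halt
  deriving Fintype

/-- Control-states of the pushdown automaton. -/
inductive PdaState (Q : Type) : Type
  /-- the machine is in control-state `q` -/
  | run (q : Q)
  /-- the history is popped -/
  | pop (phase : Bool)
  deriving Fintype

/-- Control-states of the one-counter net. -/
inductive NetState (R : Type) : Type
  /-- all claims have been accepted -/
  | follow
  /-- a claim about the register `r` is tested -/
  | test (r : R) (b : Bool)
  /-- all actions are possible for ever -/
  | all
  deriving Fintype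

/-- The popping moves of the pushdown automaton. -/
def popMoves {Q R : Type} :
    Bool → HistSymbol R → List (RunAction R × PdaState Q × List (HistSymbol R))
  | _, none => []
  | false, some o => [(.pop o false, .pop true, [some o])]
  | true, some o => [(.pop o true, .pop false, [])]

theorem mem_popMoves_false {Q R : Type} {X : HistSymbol R}
    {x : RunAction R × PdaState Q × List (HistSymbol R)} :
    x ∈ popMoves false X ↔ ∃ o, X = some o ∧ x = (.pop o false, .pop true, [some o]) := by
  cases X <;> simp [popMoves]

section Simulation

variable {Q R : Type} [DecidableEq R]

/-- The moves of the pushdown automaton, which runs the counter machine `M`. -/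
def pdaMoves (M : Q → Instr Q R) :
    PdaState Q → HistSymbol R → List (RunAction R × PdaState Q × List (HistSymbol R))
  | .run q, X => (match M q with
    | .op r b q' => [(.tick, .run q', [some (r, b), X])]
    | .test r q₁ q₀ => [(.claim r true, .run q₁, [X]), (.claim r false, .run q₀, [X])]
    | .halt => [(.halt, .run q, [X])]) ++ popMoves false X
  | .pop p, X => popMoves p X

/-- The moves of the one-counter net, which may challenge any claim. Popping without a preceding
challenge, and anything but popping after a challenge, makes the net simulate everything; so the
pushdown automaton has to pop its stack exactly after a challenge, although it does not see
challenges. -/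
def netMoves : NetState R → RunAction R → List (NetState R × SignType)
  | .follow, .tick => [(.follow, 1)]
  | .follow, .claim r b => [(.follow, 0), (.test r b, if b then 0 else -1)]
  | .follow, .pop _ _ => [(.all, 0)]
  | .follow, .halt => []
  | .test r b, .pop o p => [(.test r b, costStep r b o p)]
  | .test _ _, _ => [(.all, 0)]
  | .all, _ => [(.all, 0)]

/-- The simulation that exists if the machine does not halt. -/
inductive Matched (M : Q → Instr Q R) :
    PdaState Q → List (HistSymbol R) → NetState R → ℕ → Prop
  | follow {q l m} (hM : ¬ Halts M q (histVal l)) (hm : l.length ≤ m) :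
      Matched M (.run q) (histStack l) .follow m
  | test {s r b l m} (hs : s ≠ .pop true) (hm : histCost r b l ≤ m) :
      Matched M s (histStack l) (.test r b) m
  | test' {r b o l} {m : ℕ} (hm : -(costStep r b o true : ℤ) + histCost r b l ≤ m) :
      Matched M (.pop true) (some o :: histStack l) (.test r b) m
  | all {s l m} : Matched M s l .all m

variable {M : Q → Instr Q R}

theorem simulatedBy_of_not_halts [Fintype Q] [Fintype R] {q₀ : Q} {r₀ : R} {n : ℕ}
    (hM : ¬ Halts M q₀ (Function.update 0 r₀ (n : ℤ))) (hl : histStack (inputHist r₀ n) ≠ []) :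
    SimulatedBy (pdaOf (pdaMoves M)).Step (netOf (netMoves (R := R))).Step
      (pdaConfig (pdaMoves M) (.run q₀) (histStack (inputHist r₀ n)) hl)
      (netConfig netMoves .follow n) := by
  refine simulatedBy_of_invariant (Matched M) ?_ hl
    (.follow (by rwa [histVal_inputHist]) (by simp [inputHist]))
  intro s X l t m h x hx _
  generalize hl' : X :: l = l' at h
  cases h with
  | @follow q l₁ m hM hm =>
    rcases List.mem_append.1 hx with hx | hx
    · match hi : M q with
      | .op r b q' =>
        rw [hi] at hx
        obtain rfl := List.mem_singleton.1 hx
        rw [halts_op hi] at hM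
        refine ⟨(.follow, 1), by simp [netMoves], m + 1, by simp, ?_⟩
        have := Matched.follow (l := (r, b) :: l₁) (m := m + 1) hM (by simpa using hm)
        simpa [histStack_cons, ← hl'] using this
      | .test r q₁ q₂ =>
        rw [hi] at hx
        rw [halts_test hi] at hM
        have key : ∀ b q', ((b = true ↔ 1 ≤ histVal l₁ r) → ¬ Halts M q' (histVal l₁)) →
            ∃ y ∈ netMoves .follow (.claim r b), ∃ m' : ℕ, (m' : ℤ) = m + y.2 ∧
              Matched M (.run q') (histStack l₁) y.1 m' := by
          intro b q' hq'
          by_cases hb : b = true ↔ 1 ≤ histVal l₁ r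
          · exact ⟨(.follow, 0), by simp [netMoves], m, by simp, .follow (hq' hb) hm⟩
          · have hc := histCost_eq r b l₁
            refine ⟨(.test r b, if b then 0 else -1), by simp [netMoves], ?_⟩
            cases b
            · have : 1 ≤ histVal l₁ r := by simpa using hb
              simp only [Bool.false_eq_true, if_false] at hc
              exact ⟨m - 1, by simp; omega, .test (by simp) (by omega)⟩
            · have : ¬ 1 ≤ histVal l₁ r := by simpa using hb
              simp only [if_true] at hc
              exact ⟨m, by simp, .test (by simp) (by omega)⟩
        simp only [List.mem_cons, List.not_mem_nil, or_false] at hx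
        rcases hx with rfl | rfl
        · have := key true q₁ fun h => by simpa [h.1 rfl] using hM
          simpa [hl'] using this
        · have := key false q₂ fun h => by
            simpa [show ¬ 1 ≤ histVal l₁ r by simpa using h] using hM
          simpa [hl'] using this
      | .halt => exact absurd (halts_halt hi _) hM
    · obtain ⟨o, rfl, rfl⟩ := mem_popMoves_false.1 hx
      exact ⟨(.all, 0), by simp [netMoves], m, by simp, .all⟩
  | @test s r b l₁ m hs hm =>
    have hpop : x ∈ popMoves false X → ∃ y ∈ netMoves (.test r b) x.1, ∃ m' : ℕ,
        (m' : ℤ) = m + y.2 ∧ Matched M x.2.1 (x.2.2 ++ l) y.1 m' := by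
      intro hx
      obtain ⟨o, rfl, rfl⟩ := mem_popMoves_false.1 hx
      cases l₁ with
      | nil => cases hl'
      | cons o' l₁ =>
        obtain ⟨h, rfl⟩ := List.cons.inj hl'
        obtain rfl := Option.some.inj h
        have h₁ := costStep_add r b o
        have h₂ := costStep_nonpos r b o true
        rw [histCost_cons] at hm
        refine ⟨(.test r b, costStep r b o false), by simp [netMoves],
          (m + (costStep r b o false : ℤ)).toNat, ?_, .test' ?_⟩
        · simp only
          omega
        · omega
    match s, hs with
    | .pop false, _ => exact hpop hx
    | .run q, _ =>
      rcases List.mem_append.1 hx with hx | hx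
      · refine ⟨(.all, 0), ?_, m, by simp, .all⟩
        match hi : M q with
        | .op r b q' =>
          rw [hi] at hx
          obtain rfl := List.mem_singleton.1 hx
          simp [netMoves]
        | .test r q₁ q₂ =>
          rw [hi] at hx
          simp only [List.mem_cons, List.not_mem_nil, or_false] at hx
          rcases hx with rfl | rfl <;> simp [netMoves]
        | .halt =>
          rw [hi] at hx
          obtain rfl := List.mem_singleton.1 hx
          simp [netMoves]
      · exact hpop hx
  | @test' r b o l₁ m hm =>
    obtain ⟨rfl, rfl⟩ := List.cons.inj hl'
    obtain rfl := List.mem_singleton.1 hx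
    refine ⟨(.test r b, costStep r b o true), by simp [netMoves],
      (m + (costStep r b o true : ℤ)).toNat, ?_, .test (by simp) ?_⟩
    · simp only
      omega
    · omega
  | all => exact ⟨(.all, 0), by cases x.1 <;> simp [netMoves], m, by simp, .all⟩

/-- The net cannot match the popping of a history that costs more than its counter contains. -/
theorem unmatched_pop (r : R) (b : Bool) : ∀ (l : List (R × Bool)) (s : PdaState Q) (m : ℕ),
    s ≠ .pop true → m < histCost r b l →
      Unmatched (pdaMoves M) netMoves s (histStack l) (.test r b) m
  | [], _, _, _, h => by simp [histCost] at h
  | o :: l, s, m, hs, h => by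
    rw [histCost_cons] at h
    refine .step (.pop o false, .pop true, [some o]) ?_ (by simp) fun y hy m' hm' => ?_
    · match s, hs with
      | .pop false, _ => simp [pdaMoves, popMoves]
      | .run q, _ => simp [pdaMoves, popMoves]
    obtain rfl := List.mem_singleton.1 hy
    refine .step (.pop o true, .pop false, []) (by simp [pdaMoves, popMoves]) (by simp)
      fun y hy m'' hm'' => ?_
    obtain rfl := List.mem_singleton.1 hy
    refine unmatched_pop r b l _ m'' (by simp) ?_
    have := costStep_add r b o
    simp only at hm' hm''
    omega

/-- If the machine halts, the pushdown automaton runs it with true claims only: a challenge fails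
in the test, and the final action `halt` cannot be matched. -/
theorem unmatched_of_halts {q : Q} {s : R → ℤ} (h : Halts M q s) : ∀ l : List (R × Bool),
    histVal l = s → Unmatched (pdaMoves M) netMoves (.run q) (histStack l) .follow l.length := by
  have hcons : ∀ l : List (R × Bool), ∃ X l', histStack l = X :: l' := fun l =>
    List.exists_cons_of_ne_nil (by simp [histStack])
  refine Halts.induction (P := fun q s => ∀ l : List (R × Bool), histVal l = s →
      Unmatched (pdaMoves M) netMoves (.run q) (histStack l) .follow l.length)
    (fun q s hi => ?_) (fun q s r b q' hi ih => ?_) (fun q s r q₁ q₂ hi ih => ?_) h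
  · rintro l -
    obtain ⟨X, l', hl⟩ := hcons l
    rw [hl]
    exact .step (.halt, .run q, [X]) (by simp [pdaMoves, hi]) (by simp)
      fun y hy => by simp [netMoves] at hy
  · rintro l rfl
    have := ih ((r, b) :: l) rfl
    rw [histStack_cons] at this
    obtain ⟨X, l', hl⟩ := hcons l
    rw [hl] at this ⊢
    refine .step (.tick, .run q', [some (r, b), X]) (by simp [pdaMoves, hi]) (by simp)
      fun y hy m' hm' => ?_
    obtain rfl := List.mem_singleton.1 hy
    obtain rfl : m' = l.length + 1 := by simp at hm'; omega
    exact this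
  · rintro l rfl
    have key : ∀ b q', (RunAction.claim r b, .run q', [(histStack l).head (by simp [histStack])]) ∈
          pdaMoves M (.run q) ((histStack l).head (by simp [histStack])) →
        (b = true ↔ 1 ≤ histVal l r) →
        Unmatched (pdaMoves M) netMoves (.run q') (histStack l) .follow l.length →
        Unmatched (pdaMoves M) netMoves (.run q) (histStack l) .follow l.length := by
      intro b q' hmem hb h
      have hpop : ∀ m : ℕ, (m : ℤ) = l.length + (if b then 0 else -1) →
          Unmatched (pdaMoves M) netMoves (.run q') (histStack l) (.test r b) m := by
        intro m hm
        refine unmatched_pop r b l _ m (by simp) ?_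
        have hc := histCost_eq r b l
        cases b
        · have : ¬ 1 ≤ histVal l r := by simpa using hb
          simp only [Bool.false_eq_true, if_false] at hc hm
          omega
        · have : 1 ≤ histVal l r := by simpa using hb
          simp only [if_true] at hc hm
          omega
      obtain ⟨X, l', hl⟩ := hcons l
      simp only [hl, List.head_cons] at h hpop hmem ⊢
      refine .step (.claim r b, .run q', [X]) hmem (by simp) fun y hy m' hm' => ?_
      simp only [netMoves, List.mem_cons, List.not_mem_nil, or_false] at hy
      rcases hy with rfl | rfl
      · obtain rfl : m' = l.length := by simpa using hm'
        exact h
      · exact hpop m' (by cases b <;> simpa using hm')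
    have ih := ih l rfl
    by_cases hr : 1 ≤ histVal l r
    · rw [if_pos hr] at ih
      exact key true q₁ (by simp [pdaMoves, hi]) (by simp [hr]) ih
    · rw [if_neg hr] at ih
      exact key false q₂ (by simp [pdaMoves, hi]) (by simp [hr]) ih

end Simulation

/-! ### Computability of the reductions -/

theorem Primrec.flatMap_const {α β : Type} [Primcodable β] {F : α → ℕ → List β}
    (hF : ∀ a, Primrec (F a)) : ∀ l : List α, Primrec fun n => l.flatMap fun a => F a n
  | [] => .const []
  | a :: l => .of_eq (Primrec.list_append.comp (hF a) (Primrec.flatMap_const hF l))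
      fun n => by simp

theorem primrec_map_histStack {R α : Type} [Primcodable α] (g : HistSymbol R → α) (r : R) :
    Primrec fun n => (histStack (inputHist r n)).map g :=
  .of_eq (f := fun n => (List.range n).map (fun _ => g (some (r, true))) ++ [g none])
    (Primrec.list_append.comp (Primrec.list_map Primrec.list_range (Primrec.const _).to₂)
      (.const _))
    fun n => by simp [histStack, inputHist]

section Code

variable {Q R : Type} [DecidableEq R] [Fintype Q] [Fintype R]

/-- Only two transitions of the game depend on the input, through the words that they push. -/
theorem primrec_code_machineArena (M : Q → Instr Q R) (q₀ : Q) (r₀ : R) (d : ℕ) :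
    Primrec fun n => ((machineArena M q₀ r₀ n).game d).code := by
  refine (Primrec.const _).pair ((Primrec.const _).pair ((Primrec.const _).pair ?_))
  simp only [Arena.game, List.map_flatMap, List.map_map]
  refine Primrec.flatMap_const (fun a => ?_) _
  obtain ⟨s, X⟩ := a
  rcases s with (q | ⟨r, b, _ | _⟩ | _ | _ | _ | _) | ⟨r, b, q⟩ <;> rcases X with _ | o <;>
    simp only [machineArena, List.map_cons, List.map_nil, Function.comp_def, List.map_map]
  all_goals first
    | exact Primrec.const _
    | skip
  all_goals
    refine Primrec.list_cons.comp (.const _) (Primrec.list_cons.comp ?_ (.const _))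
    exact (Primrec.const _).pair ((Primrec.const _).pair ((Primrec.const _).pair
      ((primrec_map_histStack _ r₀).pair (.const _))))

end Code

/-- A decision problem is undecidable if an undecidable set of numbers reduces to it. -/
theorem not_decidableProblem_of_reduction {I α : Type} [Primcodable α] {code : I → α}
    {P : I → Prop} {p : ℕ → Prop} (hp : ¬ ComputablePred p) (x : ℕ → I)
    (hx : Computable fun n => code (x n)) (h : ∀ n, P (x n) ↔ ¬ p n) :
    ¬ DecidableProblem code P := by
  rintro ⟨f, hf, hfP⟩
  refine hp (ComputablePred.computable_iff.2
    ⟨fun n => !f (code (x n)), Primrec.not.to_comp.comp (hf.comp hx), ?_⟩)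
  funext n
  have := (hfP (x n)).trans (h n)
  cases hfx : f (code (x n)) <;> simp_all

section Instances

variable {Q R : Type} [DecidableEq R] [Fintype Q] [Fintype R]

/-- The instance of the unknown initial credit problem for the machine `M` with input `n`. -/
noncomputable def creditInstance (M : Q → Instr Q R) (q₀ : Q) (r₀ : R) (d n : ℕ) :
    UnknownCreditInstance d where
  game := (machineArena M q₀ r₀ n).game d
  total := Arena.game_total (machineArena_total M q₀ r₀ n) d
  state := (machineArena M q₀ r₀ n).encState d (.inl .restart)
  stack := [(machineArena M q₀ r₀ n).encSymbol d none]
  stack_ne := List.cons_ne_nil _ _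

theorem primrec_code_creditInstance (M : Q → Instr Q R) (q₀ : Q) (r₀ : R) (d : ℕ) :
    Primrec fun n => (creditInstance M q₀ r₀ d n).code :=
  -- The start state and start stack have the same codes as for input `0`.
  .of_eq (f := fun n => (((machineArena M q₀ r₀ n).game d).code,
      Sum.map Fin.val Fin.val (creditInstance M q₀ r₀ d 0).state,
      (creditInstance M q₀ r₀ d 0).stack.map Fin.val))
    ((primrec_code_machineArena M q₀ r₀ d).pair ((Primrec.const _).pair (.const _)))
    fun _ => rfl

theorem player1Wins_start_zero {M : Q → Instr Q R} {q₀ : Q} {r₀ : R} {d n : ℕ}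
    (h : ¬ Halts M q₀ (Function.update 0 r₀ (n : ℤ))) :
    (creditInstance M q₀ r₀ d n).game.Player1Wins ((creditInstance M q₀ r₀ d n).start 0) :=
  player1Wins_of_not_halts h d

theorem not_player1Wins_start {M : Q → Instr Q R} {q₀ : Q} {r₀ : R} {d n : ℕ} (hd : 1 ≤ d)
    (h : Halts M q₀ (Function.update 0 r₀ (n : ℤ))) (E : Fin d → ℕ) :
    ¬ (creditInstance M q₀ r₀ d n).game.Player1Wins ((creditInstance M q₀ r₀ d n).start E) := by
  have hlost := lost_restart h (E ⟨0, hd⟩ + 1) (E ⟨0, hd⟩) (by simp)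
  have := hlost.not_player1Wins (machineArena_total M q₀ r₀ n) (d := d)
    -- Relative to the constant offset `v`, all components of the energy agree with component `0`.
    (v := fun i => (E i : ℤ) - E ⟨0, hd⟩) (i := ⟨0, hd⟩) (by simp) (List.cons_ne_nil _ _)
  have e : (machineArena M q₀ r₀ n).config d (fun i => (E i : ℤ) - E ⟨0, hd⟩) (.inl .restart)
      [none] (List.cons_ne_nil _ _) (E ⟨0, hd⟩) = (creditInstance M q₀ r₀ d n).start E := by
    simp only [Arena.config, sub_add_cancel]
    rfl
  rwa [e] at this

/-- The instance of the simulation problem for the machine `M` with input `n`. -/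
noncomputable def simulationInstance (M : Q → Instr Q R) (q₀ : Q) (r₀ : R) (n : ℕ) :
    SimulationInstance where
  numActions := Fintype.card (RunAction R)
  pda := pdaOf (pdaMoves M)
  net := netOf netMoves
  pdaStart := pdaConfig (pdaMoves M) (.run q₀) (histStack (inputHist r₀ n)) (by simp [histStack])
  netStart := netConfig netMoves .follow n

theorem primrec_code_simulationInstance (M : Q → Instr Q R) (q₀ : Q) (r₀ : R) :
    Primrec fun n => (simulationInstance M q₀ r₀ n).code := by
  have h : Primrec fun n => (simulationInstance M q₀ r₀ n).pdaStart.stack.map Fin.val :=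
    .of_eq (primrec_map_histStack (fun X => (pdaSymbol (pdaMoves M) X).val) r₀)
      fun n => by simp [simulationInstance, pdaConfig, Function.comp_def]
  exact .of_eq (f := fun n => (Fintype.card (RunAction R),
      ((pdaOf (pdaMoves M)).code, (pdaState (pdaMoves M) (.run q₀)).val,
        (simulationInstance M q₀ r₀ n).pdaStart.stack.map Fin.val),
      (netOf (netMoves (R := R))).code, (netState (netMoves (R := R)) .follow).val, n))
    ((Primrec.const _).pair (((Primrec.const _).pair ((Primrec.const _).pair h)).pair
      ((Primrec.const _).pair ((Primrec.const _).pair .id))))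
    fun _ => rfl

theorem simulationInstance_holds_iff (M : Q → Instr Q R) (q₀ : Q) (r₀ : R) (n : ℕ) :
    (simulationInstance M q₀ r₀ n).Holds ↔ ¬ Halts M q₀ (Function.update 0 r₀ (n : ℤ)) := by
  refine ⟨fun h hM => ?_, fun hM => simulatedBy_of_not_halts hM (by simp [histStack])⟩
  have := unmatched_of_halts hM (inputHist r₀ n) (histVal_inputHist r₀ n)
  rw [show (inputHist r₀ n).length = n by simp [inputHist]] at this
  exact this.not_simulatedBy (by simp [histStack]) h

end Instances

theorem mainTheorem6 :
    (∀ n : ℕ, 1 ≤ n →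
      ¬ DecidableProblem (FixedCreditInstance.code (n := n)) FixedCreditInstance.Holds) ∧
    (∀ n : ℕ, 1 ≤ n →
      ¬ DecidableProblem (UnknownCreditInstance.code (n := n)) UnknownCreditInstance.Holds) ∧
    ¬ DecidableProblem SimulationInstance.code SimulationInstance.Holds := by
  obtain ⟨Q, R, _, _, _, M, q₀, r₀, hM⟩ := exists_undecidable_machine
  refine ⟨fun d hd => ?_, fun d hd => ?_, ?_⟩
  · refine not_decidableProblem_of_reduction hM (fun n => ⟨creditInstance M q₀ r₀ d n, 0⟩)
      ((primrec_code_creditInstance M q₀ r₀ d).pair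
        (.const (List.ofFn (0 : Fin d → ℕ)))).to_comp fun n => ?_
    exact ⟨fun h hM => not_player1Wins_start hd hM 0 h, player1Wins_start_zero⟩
  · refine not_decidableProblem_of_reduction hM (creditInstance M q₀ r₀ d)
      (primrec_code_creditInstance M q₀ r₀ d).to_comp fun n => ?_
    exact ⟨fun ⟨E, h⟩ hM => not_player1Wins_start hd hM E h, fun h => ⟨0, player1Wins_start_zero h⟩⟩
  · exact not_decidableProblem_of_reduction hM (simulationInstance M q₀ r₀)
      (primrec_code_simulationInstance M q₀ r₀).to_comp (simulationInstance_holds_iff M q₀ r₀)
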